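/- Consider third-order evolution equations $u_t=F(t,x,u,u_1,u_2)\,u_3+G(t,x,u,u_1,u_2)$, where $u_k=\partial_x^k u$, with $F,G$ smooth and $F$ nowhere zero on a non-empty open set $\Omega$ of $(t,x,u,u_1,u_2)$-space on which $\cos u\neq0$. Let $M$ be the projection of $\Omega$ to $(t,x,u)$-space. A smooth vector field $Q=a\,\partial_t+b\,\partial_x+c\,\partial_u$ on $M$ is a symmetry of the equation if its third prolongation annihilates $\Delta=u_t-Fu_3-G$ on $\Delta=0$ over $\Omega$; a Lie algebra of vector fields is admitted by the equation if all its elements are symmetries. An equivalence transformation is an invertible smooth transformation $t'=T(t)$, $x'=X(t,x,u)$, $u'=U(t,x,u)$ of $M$ onto an open set $M'$. Let \[ \mathfrak s=\langle \partial_x,\ \tan u\,\sin x\,\partial_x+\cos x\,\partial_u,\ \tan u\,\cos x\,\partial_x-\sin x\,\partial_u\rangle , \] a realization of $\mathrm{so}(3,\mathbb R)$. A direct sum extension of $\mathfrak s$ is a Lie algebra $\mathfrak s\oplus A$, where $A\neq0$ is a Lie algebra of smooth vector fields $a(t)\partial_t+b(t,x,u)\partial_x+c(t,x,u)\partial_u$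 on $M$ that commute with $\mathfrak s$ and $\mathfrak s\cap A=0$. 1. $\mathfrak s\oplus\langle\partial_t\rangle$ is a direct sum extension of $\mathfrak s$ and is admitted by some equation on $\Omega$. 2. It is the only one up to equivalence: if $\Omega$ is connected and $\mathfrak s\oplus A$ is a direct sum extension admitted by some equation on $\Omega$, then there is an equivalence transformation with $\cos u'\neq 0$ on $M'$ that carries each of the three generators of $\mathfrak s$ to the vector field of the same form and carries $A$ onto $\langle\partial_{t'}\rangle$. 3. An equation on $\Omega$ admits $\mathfrak s\oplus\langle\partial_t\rangle$ if and only if, in a neighbourhood of each point of $\Omega$, \[ F=\frac{\sec^3 u}{(1+\omega^2)^{3/2}}\,f(\tau), \] \[ \begin{split} G=&\left[9\omega\tau\tan u-3\omega\tau^2(1+\omega^2)^{1/2}+\frac{\omega(1+2\omega^2)}{(1+\omega^2)^{3/2}}-\frac{\omega(5+6\omega^2)\tan^2u}{(1+\omega^2)^{3/2}}\right]f(\tau)\\ &+(1+\omega^2)^{1/2}h(\tau), \end{split} \] where \[ \omega=u_1\sec u,\qquad \tau=\frac{u_2\sec^2u+(1+2\omega^2)\tan u}{(1+\omega^2)^{3/2}},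 \] for some smooth functions $f\neq0$ and $h$ of $\tau$ only. If all level sets of $\tau$ in $\Omega$ are connected (for instance $\Omega=I\times\mathbb R\times(-\frac\pi2,\frac\pi2)\times\mathbb R^2$ with an open interval $I$), then an equation on $\Omega$ admits $\mathfrak s\oplus\langle\partial_t\rangle$ if and only if $F,G$ have this form on all of $\Omega$ with one pair $f,h$. -/

import Mathlib

open scoped ContDiff

/-- The space of the variables `(t, x, u)`. -/
abbrev Point : Type := ℝ × ℝ × ℝ

/-- The space of the variables `(t, x, u, u₁, u₂)` on which the nonlinearities `F`, `G` live. -/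
abbrev Jet : Type := ℝ × ℝ × ℝ × ℝ × ℝ

/-! ### Vector fields on an open set of `(t, x, u)`-space and their Lie algebra -/

/-- Smooth vector fields `Q = a ∂_t + b ∂_x + c ∂_u` on the open set `M`, written as the map
`(t, x, u) ↦ (a, b, c)`. A vector field on `M` is represented by its extension by zero, so that
two vector fields are equal exactly when they agree on `M`. -/
def smoothFields (M : TopologicalSpace.Opens Point) : Submodule ℝ (Point → Point) where
  carrier := {Q | ContDiffOn ℝ ∞ Q M ∧ ∀ p ∉ M, Q p = 0}
  add_mem' {P Q} hP hQ := ⟨hP.1.add hQ.1, fun p hp => by simp [hP.2 p hp, hQ.2 p hp]⟩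
  zero_mem' := ⟨contDiffOn_const, fun _ _ => rfl⟩
  smul_mem' k Q hQ := ⟨hQ.1.const_smul k, fun p hp => by simp [hQ.2 p hp]⟩

/-- The space of smooth vector fields on `M`. -/
abbrev VField (M : TopologicalSpace.Opens Point) : Type := ↥(smoothFields M)

namespace VField

variable {M : TopologicalSpace.Opens Point}

theorem contDiffAt (X : VField M) {p : Point} (hp : p ∈ M) : ContDiffAt ℝ ∞ X.1 p :=
  X.2.1.contDiffAt (M.isOpen.mem_nhds hp)

theorem differentiableAt (X : VField M) {p : Point} (hp : p ∈ M) :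
    DifferentiableAt ℝ X.1 p :=
  (X.contDiffAt hp).differentiableAt (by simp)

theorem ext_on {X Y : VField M} (h : ∀ p ∈ M, X.1 p = Y.1 p) : X = Y := by
  apply Subtype.ext
  funext p
  by_cases hp : p ∈ M
  · exact h p hp
  · rw [X.2.2 p hp, Y.2.2 p hp]

/-- A vector field on `M` given by its values on `M`. -/
noncomputable def ofFun (Q : Point → Point) (hQ : ContDiffOn ℝ ∞ Q M) : VField M :=
  ⟨Set.indicator (M : Set Point) Q,
    hQ.congr fun _ hp => Set.indicator_of_mem hp Q,
    fun _ hp => Set.indicator_of_notMem hp Q⟩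

theorem ofFun_apply (Q : Point → Point) (hQ : ContDiffOn ℝ ∞ Q M) {p : Point} (hp : p ∈ M) :
    (ofFun Q hQ).1 p = Q p :=
  Set.indicator_of_mem hp Q

theorem contDiffOn_lieBracket (X Y : VField M) :
    ContDiffOn ℝ ∞ (VectorField.lieBracket ℝ X.1 Y.1) M := fun _ hp =>
  ((X.contDiffAt hp).lieBracket_vectorField (Y.contDiffAt hp) (by simp)).contDiffWithinAt

/-- The commutator `[X, Y] = X Y - Y X` of vector fields on `M`. -/
noncomputable instance : Bracket (VField M) (VField M) where
  bracket X Y := ofFun (VectorField.lieBracket ℝ X.1 Y.1) (contDiffOn_lieBracket X Y)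

theorem lie_apply (X Y : VField M) {p : Point} (hp : p ∈ M) :
    (⁅X, Y⁆ : VField M).1 p = VectorField.lieBracket ℝ X.1 Y.1 p :=
  ofFun_apply _ _ hp

theorem lie_eventuallyEq (X Y : VField M) {p : Point} (hp : p ∈ M) :
    (⁅X, Y⁆ : VField M).1 =ᶠ[nhds p] VectorField.lieBracket ℝ X.1 Y.1 := by
  filter_upwards [M.isOpen.mem_nhds hp] with q hq using lie_apply X Y hq

noncomputable instance : LieRing (VField M) where
  add_lie X Y Z := ext_on fun p hp => by
    rw [lie_apply _ _ hp]
    change _ = (⁅X, Z⁆ : VField M).1 p + (⁅Y, Z⁆ : VField M).1 p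
    rw [lie_apply _ _ hp, lie_apply _ _ hp]
    exact VectorField.lieBracket_add_left (X.differentiableAt hp) (Y.differentiableAt hp)
  lie_add X Y Z := ext_on fun p hp => by
    rw [lie_apply _ _ hp]
    change _ = (⁅X, Y⁆ : VField M).1 p + (⁅X, Z⁆ : VField M).1 p
    rw [lie_apply _ _ hp, lie_apply _ _ hp]
    exact VectorField.lieBracket_add_right (Y.differentiableAt hp) (Z.differentiableAt hp)
  lie_self X := ext_on fun p hp => by
    rw [lie_apply _ _ hp]
    simp
  leibniz_lie X Y Z := ext_on fun p hp => by
    change _ = (⁅⁅X, Y⁆, Z⁆ : VField M).1 p + (⁅Y, ⁅X, Z⁆⁆ : VField M).1 p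
    rw [lie_apply _ _ hp, lie_apply _ _ hp, lie_apply _ _ hp,
      Filter.EventuallyEq.lieBracket_vectorField_eq Filter.EventuallyEq.rfl
        (lie_eventuallyEq Y Z hp),
      Filter.EventuallyEq.lieBracket_vectorField_eq (lie_eventuallyEq X Y hp)
        Filter.EventuallyEq.rfl,
      Filter.EventuallyEq.lieBracket_vectorField_eq Filter.EventuallyEq.rfl
        (lie_eventuallyEq X Z hp)]
    exact VectorField.leibniz_identity_lieBracket (n := ∞)
      (by rw [minSmoothness_of_isRCLikeNormedField]; exact ENat.LEInfty.out)
      (X.contDiffAt hp) (Y.contDiffAt hp) (Z.contDiffAt hp)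

noncomputable instance : LieAlgebra ℝ (VField M) where
  lie_smul k X Y := ext_on fun p hp => by
    rw [lie_apply _ _ hp]
    change _ = k • (⁅X, Y⁆ : VField M).1 p
    rw [lie_apply _ _ hp]
    exact VectorField.lieBracket_const_smul_right (Y.differentiableAt hp)

end VField

/-! ### The realization of `so(3, ℝ)` and time translations -/

/-- `cos u ≠ 0` on `M`, so that `tan u` and `sec u` make sense there. -/
def CosNeZero (M : TopologicalSpace.Opens Point) : Prop :=
  ∀ p ∈ M, Real.cos p.2.2 ≠ 0

theorem contDiffOn_tan_u {M : TopologicalSpace.Opens Point} (hM : CosNeZero M) :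
    ContDiffOn ℝ ∞ (fun p : Point => Real.tan p.2.2) M := fun p hp =>
  ((Real.contDiffAt_tan.2 (hM p hp)).comp p
    (contDiff_snd.comp contDiff_snd).contDiffAt).contDiffWithinAt

/-- The vector fields `∂_x`, `tan u sin x ∂_x + cos x ∂_u`, `tan u cos x ∂_x - sin x ∂_u`. -/
noncomputable def so3Gen (M : TopologicalSpace.Opens Point) (hM : CosNeZero M) :
    Fin 3 → VField M :=
  ![VField.ofFun (fun _ => (0, 1, 0)) contDiffOn_const,
    VField.ofFun (fun p => (0, Real.tan p.2.2 * Real.sin p.2.1, Real.cos p.2.1))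
      (contDiffOn_const.prodMk (((contDiffOn_tan_u hM).mul (by fun_prop)).prodMk (by fun_prop))),
    VField.ofFun (fun p => (0, Real.tan p.2.2 * Real.cos p.2.1, -Real.sin p.2.1))
      (contDiffOn_const.prodMk (((contDiffOn_tan_u hM).mul (by fun_prop)).prodMk (by fun_prop)))]

/-- The vector field `∂_t`. -/
noncomputable def dtField (M : TopologicalSpace.Opens Point) : VField M :=
  VField.ofFun (fun _ => (1, 0, 0)) contDiffOn_const

theorem so3Gen_zero_apply {M : TopologicalSpace.Opens Point} (hM : CosNeZero M)
    {p : Point} (hp : p ∈ M) : (so3Gen M hM 0).1 p = (0, 1, 0) :=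
  Set.indicator_of_mem (s := (M : Set Point)) hp (fun _ => ((0, 1, 0) : Point))

theorem so3Gen_one_apply {M : TopologicalSpace.Opens Point} (hM : CosNeZero M)
    {p : Point} (hp : p ∈ M) : (so3Gen M hM 1).1 p =
      (0, Real.tan p.2.2 * Real.sin p.2.1, Real.cos p.2.1) :=
  Set.indicator_of_mem (s := (M : Set Point)) hp
    (fun p => (0, Real.tan p.2.2 * Real.sin p.2.1, Real.cos p.2.1))

theorem so3Gen_two_apply {M : TopologicalSpace.Opens Point} (hM : CosNeZero M)
    {p : Point} (hp : p ∈ M) : (so3Gen M hM 2).1 p =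
      (0, Real.tan p.2.2 * Real.cos p.2.1, -Real.sin p.2.1) :=
  Set.indicator_of_mem (s := (M : Set Point)) hp
    (fun p => (0, Real.tan p.2.2 * Real.cos p.2.1, -Real.sin p.2.1))

theorem fderiv_so3Gen_one {M : TopologicalSpace.Opens Point} (hM : CosNeZero M)
    {p : Point} (hp : p ∈ M) (w : Point) :
    fderiv ℝ (so3Gen M hM 1).1 p w =
      (0, (1 / Real.cos p.2.2 ^ 2 * w.2.2) * Real.sin p.2.1
        + Real.tan p.2.2 * (Real.cos p.2.1 * w.2.1), -Real.sin p.2.1 * w.2.1) := by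
  have hx : HasFDerivAt (fun q : Point => q.2.1) _ p :=
    ((ContinuousLinearMap.fst ℝ ℝ ℝ).comp (ContinuousLinearMap.snd ℝ ℝ (ℝ × ℝ))).hasFDerivAt
  have hu : HasFDerivAt (fun q : Point => q.2.2) _ p :=
    ((ContinuousLinearMap.snd ℝ ℝ ℝ).comp (ContinuousLinearMap.snd ℝ ℝ (ℝ × ℝ))).hasFDerivAt
  have ht := (Real.hasDerivAt_tan (hM p hp)).comp_hasFDerivAt p hu
  have h := (hasFDerivAt_const (0 : ℝ) p).prodMk ((ht.mul hx.sin).prodMk hx.cos)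
  have he : (so3Gen M hM 1).1 =ᶠ[nhds p]
      fun q => (0, Real.tan q.2.2 * Real.sin q.2.1, Real.cos q.2.1) := by
    filter_upwards [M.isOpen.mem_nhds hp] with q hq using so3Gen_one_apply hM hq
  rw [he.fderiv_eq, HasFDerivAt.fderiv (f := fun q : Point => (0, Real.tan q.2.2 * Real.sin q.2.1, Real.cos q.2.1)) h]
  simp
  ring

theorem fderiv_so3Gen_two {M : TopologicalSpace.Opens Point} (hM : CosNeZero M)
    {p : Point} (hp : p ∈ M) (w : Point) :
    fderiv ℝ (so3Gen M hM 2).1 p w =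
      (0, (1 / Real.cos p.2.2 ^ 2 * w.2.2) * Real.cos p.2.1
        - Real.tan p.2.2 * (Real.sin p.2.1 * w.2.1), -Real.cos p.2.1 * w.2.1) := by
  have hx : HasFDerivAt (fun q : Point => q.2.1) _ p :=
    ((ContinuousLinearMap.fst ℝ ℝ ℝ).comp (ContinuousLinearMap.snd ℝ ℝ (ℝ × ℝ))).hasFDerivAt
  have hu : HasFDerivAt (fun q : Point => q.2.2) _ p :=
    ((ContinuousLinearMap.snd ℝ ℝ ℝ).comp (ContinuousLinearMap.snd ℝ ℝ (ℝ × ℝ))).hasFDerivAt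
  have ht := (Real.hasDerivAt_tan (hM p hp)).comp_hasFDerivAt p hu
  have h := (hasFDerivAt_const (0 : ℝ) p).prodMk ((ht.mul hx.cos).prodMk hx.sin.fun_neg)
  have he : (so3Gen M hM 2).1 =ᶠ[nhds p]
      fun q => (0, Real.tan q.2.2 * Real.cos q.2.1, -Real.sin q.2.1) := by
    filter_upwards [M.isOpen.mem_nhds hp] with q hq using so3Gen_two_apply hM hq
  rw [he.fderiv_eq, HasFDerivAt.fderiv (f := fun q : Point => (0, Real.tan q.2.2 * Real.cos q.2.1, -Real.sin q.2.1)) h]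
  simp
  ring

theorem fderiv_so3Gen_zero {M : TopologicalSpace.Opens Point} (hM : CosNeZero M)
    {p : Point} (hp : p ∈ M) (w : Point) :
    fderiv ℝ (so3Gen M hM 0).1 p w = 0 := by
  have he : (so3Gen M hM 0).1 =ᶠ[nhds p] fun _ => (0, 1, 0) := by
    filter_upwards [M.isOpen.mem_nhds hp] with q hq using so3Gen_zero_apply hM hq
  rw [he.fderiv_eq]
  simp

/-- The commutation relations of `so(3, ℝ)`. -/
theorem so3Gen_lie (M : TopologicalSpace.Opens Point) (hM : CosNeZero M) :
    ⁅so3Gen M hM 0, so3Gen M hM 1⁆ = so3Gen M hM 2 ∧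
    ⁅so3Gen M hM 1, so3Gen M hM 2⁆ = so3Gen M hM 0 ∧
    ⁅so3Gen M hM 2, so3Gen M hM 0⁆ = so3Gen M hM 1 := by
  have h0 : ∀ p ∈ M, _ := fun p hp => so3Gen_zero_apply hM (p := p) hp
  have h1 : ∀ p ∈ M, _ := fun p hp => so3Gen_one_apply hM (p := p) hp
  have h2 : ∀ p ∈ M, _ := fun p hp => so3Gen_two_apply hM (p := p) hp
  refine ⟨VField.ext_on fun p hp => ?_, VField.ext_on fun p hp => ?_,
    VField.ext_on fun p hp => ?_⟩
  · rw [VField.lie_apply _ _ hp, VectorField.lieBracket, fderiv_so3Gen_one hM hp,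
      fderiv_so3Gen_zero hM hp, h0 p hp, h2 p hp]
    simp
  · rw [VField.lie_apply _ _ hp, VectorField.lieBracket, fderiv_so3Gen_one hM hp,
      fderiv_so3Gen_two hM hp, h0 p hp, h1 p hp, h2 p hp]
    have hc := hM p hp
    have hs := Real.sin_sq_add_cos_sq p.2.1
    have hs2 := Real.sin_sq_add_cos_sq p.2.2
    refine Prod.ext ?_ (Prod.ext ?_ ?_)
    · simp
    · simp only [Prod.snd_sub, Prod.fst_sub, Real.tan_eq_sin_div_cos]
      field_simp
      linear_combination (1 - Real.sin p.2.2 ^ 2) * hs - hs2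
    · simp only [Prod.snd_sub]
      ring
  · rw [VField.lie_apply _ _ hp, VectorField.lieBracket, fderiv_so3Gen_two hM hp,
      fderiv_so3Gen_zero hM hp, h0 p hp, h1 p hp]
    simp

theorem so3Gen_lie_mem (M : TopologicalSpace.Opens Point) (hM : CosNeZero M) (i j : Fin 3) :
    ⁅so3Gen M hM i, so3Gen M hM j⁆ ∈ Submodule.span ℝ (Set.range (so3Gen M hM)) := by
  obtain ⟨h01, h12, h20⟩ := so3Gen_lie M hM
  have hm : ∀ k, so3Gen M hM k ∈ Submodule.span ℝ (Set.range (so3Gen M hM)) :=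
    fun k => Submodule.subset_span ⟨k, rfl⟩
  fin_cases i <;> fin_cases j <;>
    simp only [Fin.zero_eta, Fin.mk_one, Fin.reduceFinMk, lie_self, Submodule.zero_mem]
  · rw [h01]; exact hm 2
  · rw [← lie_skew, h20]; exact Submodule.neg_mem _ (hm 1)
  · rw [← lie_skew, h01]; exact Submodule.neg_mem _ (hm 2)
  · rw [h12]; exact hm 0
  · rw [h20]; exact hm 1
  · rw [← lie_skew, h12]; exact Submodule.neg_mem _ (hm 0)

/-- The Lie algebra
`⟨∂_x, tan u sin x ∂_x + cos x ∂_u, tan u cos x ∂_x - sin x ∂_u⟩` of vector fields on `M`. -/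
noncomputable def so3 (M : TopologicalSpace.Opens Point) (hM : CosNeZero M) :
    LieSubalgebra ℝ (VField M) where
  toSubmodule := Submodule.span ℝ (Set.range (so3Gen M hM))
  lie_mem' {X Y} hX hY := by
    change X ∈ Submodule.span ℝ (Set.range (so3Gen M hM)) at hX
    change Y ∈ Submodule.span ℝ (Set.range (so3Gen M hM)) at hY
    change ⁅X, Y⁆ ∈ Submodule.span ℝ (Set.range (so3Gen M hM))
    induction hX, hY using Submodule.span_induction₂ with
    | mem_mem X Y hX hY =>
      obtain ⟨i, rfl⟩ := hX
      obtain ⟨j, rfl⟩ := hY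
      exact so3Gen_lie_mem M hM i j
    | zero_left Y hY => simp
    | zero_right X hX => simp
    | add_left X Y Z _ _ _ hX hY => rw [add_lie]; exact Submodule.add_mem _ hX hY
    | add_right X Y Z _ _ _ hX hY => rw [lie_add]; exact Submodule.add_mem _ hX hY
    | smul_left k X Y _ _ h => rw [smul_lie]; exact Submodule.smul_mem _ k h
    | smul_right k X Y _ _ h => rw [lie_smul]; exact Submodule.smul_mem _ k h

/-- The one-dimensional Lie algebra `⟨∂_t⟩` of vector fields on `M`. -/
noncomputable def dtAlgebra (M : TopologicalSpace.Opens Point) : LieSubalgebra ℝ (VField M) where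
  toSubmodule := Submodule.span ℝ {dtField M}
  lie_mem' {X Y} hX hY := by
    obtain ⟨k, rfl⟩ := Submodule.mem_span_singleton.1 hX
    obtain ⟨l, rfl⟩ := Submodule.mem_span_singleton.1 hY
    simp

/-- The Lie algebra `A` of vector fields `a(t) ∂_t + b(t,x,u) ∂_x + c(t,x,u) ∂_u` on `M` gives a
(proper) direct sum extension `so(3, ℝ) ⊕ A` of the realization `so3` of `so(3, ℝ)`. -/
structure IsDirectSumExtension (M : TopologicalSpace.Opens Point) (hM : CosNeZero M)
    (A : LieSubalgebra ℝ (VField M)) : Prop where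
  form : ∀ Q ∈ A, ∃ a : ℝ → ℝ, ∀ p ∈ M, (Q.1 p).1 = a p.1
  commute : ∀ X ∈ so3 M hM, ∀ Q ∈ A, ⁅X, Q⁆ = 0
  disjoint : Disjoint (so3 M hM) A
  ne_bot : A ≠ ⊥

/-! ### Equivalence transformations -/

/-- `φ` restricts to an invertible smooth transformation of `M` onto `M'` of the form
`t' = T(t)`, `x' = X(t,x,u)`, `u' = U(t,x,u)`. -/
structure IsEquivalenceTransformation (M M' : TopologicalSpace.Opens Point)
    (φ : Point → Point) : Prop where
  smooth : ContDiffOn ℝ ∞ φ M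
  bijOn : Set.BijOn φ M M'
  regular : ∀ p ∈ M, (fderiv ℝ φ p).IsInvertible
  time : ∃ T : ℝ → ℝ, ∀ p ∈ M, (φ p).1 = T p.1

/-- The transformation `φ` carries the vector field `Q` on `M` to the vector field `Q'` on `M'`. -/
def Carries {M M' : TopologicalSpace.Opens Point} (φ : Point → Point)
    (Q : VField M) (Q' : VField M') : Prop :=
  ∀ p ∈ M, fderiv ℝ φ p (Q.1 p) = Q'.1 (φ p)

/-- The transformation `φ` carries the Lie algebra `A` of vector fields on `M` onto the Lie
algebra `A'` of vector fields on `M'`. -/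
def CarriesOnto {M M' : TopologicalSpace.Opens Point} (φ : Point → Point)
    (A : LieSubalgebra ℝ (VField M)) (A' : LieSubalgebra ℝ (VField M')) : Prop :=
  (∀ Q ∈ A, ∃ Q' ∈ A', Carries φ Q Q') ∧ ∀ Q' ∈ A', ∃ Q ∈ A, Carries φ Q Q'

/-! ### Evolution equations and their symmetries -/

/-- The projection `(t, x, u, u₁, u₂) ↦ (t, x, u)`. -/
def proj (j : Jet) : Point := (j.1, j.2.1, j.2.2.1)

theorem isOpenMap_proj : IsOpenMap proj :=
  IsOpenMap.id.prodMap (IsOpenMap.id.prodMap isOpenMap_fst)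

/-- The open set of those `(t, x, u)` that occur in `Ω`. -/
def base (Ω : TopologicalSpace.Opens Jet) : TopologicalSpace.Opens Point :=
  ⟨proj '' (Ω : Set Jet), isOpenMap_proj _ Ω.isOpen⟩

/-- An equation `u_t = F(t,x,u,u₁,u₂) u₃ + G(t,x,u,u₁,u₂)` of third order with smooth `F`, `G`
on the open set `Ω`. -/
structure EvolutionEquation (Ω : TopologicalSpace.Opens Jet) where
  F : Jet → ℝ
  G : Jet → ℝ
  smooth_F : ContDiffOn ℝ ∞ F Ω
  smooth_G : ContDiffOn ℝ ∞ G Ω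
  F_ne_zero : ∀ j ∈ Ω, F j ≠ 0

/-- The partial derivative with respect to `t`. Along the graph `u = v(t, x)` of a function it is
the total derivative `D_t`. -/
noncomputable def dT (w : ℝ → ℝ → ℝ) : ℝ → ℝ → ℝ := fun t x => deriv (fun s => w s x) t

/-- The partial derivative with respect to `x`. Along the graph `u = v(t, x)` of a function it is
the total derivative `D_x`. -/
noncomputable def dX (w : ℝ → ℝ → ℝ) : ℝ → ℝ → ℝ := fun t x => deriv (fun y => w t y) x

/-- The point `(t, x, v, v_x, v_xx)`. -/
noncomputable def jetOf (v : ℝ → ℝ → ℝ) (t x : ℝ) : Jet :=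
  (t, x, v t x, dX v t x, dX (dX v) t x)

/-- The characteristic function `Σ = c - a u_t - b u_x` of `Q = a ∂_t + b ∂_x + c ∂_u`, along the
graph of `v`. -/
noncomputable def characteristic (Q : Point → Point) (v : ℝ → ℝ → ℝ) : ℝ → ℝ → ℝ := fun t x =>
  (Q (t, x, v t x)).2.2 - dT v t x * (Q (t, x, v t x)).1 - dX v t x * (Q (t, x, v t x)).2.1

/-- The coefficient `D Σ + a D(u_t) + b D(u_x)` of the prolongation of `Q = a ∂_t + b ∂_x + c ∂_u`
that belongs to the derivative `D u`, where `D` is a composition of total derivatives,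
along the graph of `v`. -/
noncomputable def prolongCoeff (D : (ℝ → ℝ → ℝ) → ℝ → ℝ → ℝ) (Q : Point → Point)
    (v : ℝ → ℝ → ℝ) (t x : ℝ) : ℝ :=
  D (characteristic Q v) t x + D (dT v) t x * (Q (t, x, v t x)).1
    + D (dX v) t x * (Q (t, x, v t x)).2.1

/-- The components of the second prolongation of `Q` along `∂_t, ∂_x, ∂_u, ∂_{u₁}, ∂_{u₂}`. -/
noncomputable def prolongVec (Q : Point → Point) (v : ℝ → ℝ → ℝ) (t x : ℝ) : Jet :=
  ((Q (t, x, v t x)).1, (Q (t, x, v t x)).2.1, (Q (t, x, v t x)).2.2,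
    prolongCoeff dX Q v t x, prolongCoeff (fun w => dX (dX w)) Q v t x)

namespace EvolutionEquation

variable {Ω : TopologicalSpace.Opens Jet}

/-- The function `v` satisfies the equation at the point `(t, x)`. -/
def SolvesAt (E : EvolutionEquation Ω) (v : ℝ → ℝ → ℝ) (t x : ℝ) : Prop :=
  dT v t x = E.F (jetOf v t x) * dX (dX (dX v)) t x + E.G (jetOf v t x)

/-- The value of the third prolongation of `Q` on `Δ = u_t - F u₃ - G`, at the jet of `v`
over `(t, x)`. -/
noncomputable def prolongDelta (E : EvolutionEquation Ω) (Q : Point → Point)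
    (v : ℝ → ℝ → ℝ) (t x : ℝ) : ℝ :=
  prolongCoeff dT Q v t x
    - fderiv ℝ E.F (jetOf v t x) (prolongVec Q v t x) * dX (dX (dX v)) t x
    - E.F (jetOf v t x) * prolongCoeff (fun w => dX (dX (dX w))) Q v t x
    - fderiv ℝ E.G (jetOf v t x) (prolongVec Q v t x)

/-- The vector field `Q` is an (infinitesimal point) symmetry of the equation: its third
prolongation annihilates `Δ = u_t - F u₃ - G` on the manifold `Δ = 0`. The points of the jet space
are given here as the jets of smooth functions `v`; every jet over `Ω` arises from some `v`. -/
def IsSymmetry (E : EvolutionEquation Ω) (Q : VField (base Ω)) : Prop :=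
  ∀ v : ℝ → ℝ → ℝ, ContDiff ℝ ∞ (fun q : ℝ × ℝ => v q.1 q.2) → ∀ t x : ℝ,
    jetOf v t x ∈ Ω → E.SolvesAt v t x → E.prolongDelta Q.1 v t x = 0

/-- Every element of the space `S` of vector fields is a symmetry of the equation. -/
def Admits (E : EvolutionEquation Ω) (S : Submodule ℝ (VField (base Ω))) : Prop :=
  ∀ Q ∈ S, E.IsSymmetry Q

end EvolutionEquation

/-! ### The invariant equations -/

/-- `ω = u₁ sec u`. -/
noncomputable def omegaInv (j : Jet) : ℝ := j.2.2.2.1 * (Real.cos j.2.2.1)⁻¹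

/-- `τ = (u₂ sec² u + (1 + 2 ω²) tan u) / (1 + ω²)^(3/2)`. -/
noncomputable def tauInv (j : Jet) : ℝ :=
  (j.2.2.2.2 * (Real.cos j.2.2.1)⁻¹ ^ 2 + (1 + 2 * omegaInv j ^ 2) * Real.tan j.2.2.1)
    / (1 + omegaInv j ^ 2) ^ (3 / 2 : ℝ)

/-- The nonlinearity `F`, for the value `f` of the free function. -/
noncomputable def canonicalF (f : ℝ) (j : Jet) : ℝ :=
  (Real.cos j.2.2.1)⁻¹ ^ 3 / (1 + omegaInv j ^ 2) ^ (3 / 2 : ℝ) * f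

/-- The nonlinearity `G`, for the values `f`, `h` of the free functions. -/
noncomputable def canonicalG (f h : ℝ) (j : Jet) : ℝ :=
  (9 * omegaInv j * tauInv j * Real.tan j.2.2.1
      - 3 * omegaInv j * tauInv j ^ 2 * (1 + omegaInv j ^ 2) ^ (1 / 2 : ℝ)
      + omegaInv j * (1 + 2 * omegaInv j ^ 2) / (omegaInv j ^ 2 + 1) ^ (3 / 2 : ℝ)
      - omegaInv j * (5 + 6 * omegaInv j ^ 2) * Real.tan j.2.2.1 ^ 2
          / (omegaInv j ^ 2 + 1) ^ (3 / 2 : ℝ)) * f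
    + (omegaInv j ^ 2 + 1) ^ (1 / 2 : ℝ) * h

/-- On `V` the functions `F`, `G` have the canonical form with smooth functions `f = f(τ) ≠ 0`
and `h = h(τ)`, defined for the values that `τ` takes on `V`. -/
def HasCanonicalForm (V : Set Jet) (F G : Jet → ℝ) : Prop :=
  ∃ f h : ℝ → ℝ, ContDiffOn ℝ ∞ f (tauInv '' V) ∧ ContDiffOn ℝ ∞ h (tauInv '' V) ∧
    (∀ s ∈ tauInv '' V, f s ≠ 0) ∧
    ∀ j ∈ V, F j = canonicalF (f (tauInv j)) j ∧
      G j = canonicalG (f (tauInv j)) (h (tauInv j)) j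

/-! Read `u` as latitude and `x` as longitude. Then the three generators are the infinitesimal
rotations of the unit sphere, `(1 + ω²)^(1/2) |cos u|` is the arc length element of the curve `u =
u(x)` per unit of `x`, and `τ` is, up to sign, its geodesic curvature. The canonical equations are
`u_t = sec u · f(τ) D_x τ + (1 + ω²)^(1/2) h(τ)`: the normal velocity of the curve is prescribed by
its curvature and the arc length derivative of the curvature. `canonicalG 1 0` is the part of `sec u
· D_x τ` without `u₃`.

Normal form: on `Δ = 0` the symmetry condition is affine in the free variable `u₃`, so it splits
into a homogeneous linear first-order equation for `F` and an inhomogeneous one for `G`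
(`isSymmetry_iff`). At each jet the prolonged fields fill out a four-dimensional space, which is the
kernel of `dτ` (`HasDerivAt.tauInv_prolonged`, `exists_prolonged_of_hasDerivAt_tauInv`). Since
`canonicalF 1`, `canonicalG 1 0` and `speedInv` are particular solutions of the equations that
arise, dividing and subtracting leaves two functions annihilated by all these fields. In the
coordinates `(t, x, u, u₁, τ)` such functions depend locally on `τ` alone, and globally if the level
sets of `τ` are connected (`exists_nhd_factor_tauInv`, `exists_factor_tauInv`).

Uniqueness: a field commuting with all rotations has no component along the sphere, because the
rotations about a point turn its tangent plane (`snd_eq_zero_of_commute`). So `A` consists of fields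
`a(t) ∂_t`. The equation for `F` then says `(a F)_t = 0`, and since `F ≠ 0`, such an `a` vanishes
everywhere or nowhere over a connected `Ω` (`eq_zero_iff_of_isSymmetry`). Hence `A` is
one-dimensional, and the new time `∫ dt / a(t)` turns its generator into `∂_t`. -/

open scoped Topology

/-! ### Invariants along curves in the jet space -/

/-- The function `(1 + ω²)^(1/2)`. -/
noncomputable def speedInv (j : Jet) : ℝ := (1 + omegaInv j ^ 2) ^ (1 / 2 : ℝ)

theorem speedInv_pos (j : Jet) : 0 < speedInv j := by
  unfold speedInv; positivity

theorem speedInv_sq (j : Jet) : speedInv j ^ 2 = 1 + omegaInv j ^ 2 := by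
  have h : (0 : ℝ) ≤ 1 + omegaInv j ^ 2 := by positivity
  rw [speedInv, ← Real.sqrt_eq_rpow, Real.sq_sqrt h]

theorem rpow_three_halves (j : Jet) :
    (1 + omegaInv j ^ 2) ^ (3 / 2 : ℝ) = speedInv j ^ 3 := by
  have h : (0 : ℝ) ≤ 1 + omegaInv j ^ 2 := by positivity
  rw [speedInv, ← Real.rpow_mul_natCast h]
  norm_num

theorem tauInv_eq (j : Jet) :
    tauInv j = (j.2.2.2.2 * (Real.cos j.2.2.1)⁻¹ ^ 2
      + (1 + 2 * omegaInv j ^ 2) * Real.tan j.2.2.1) / speedInv j ^ 3 := by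
  rw [tauInv, rpow_three_halves]

theorem canonicalF_eq (f : ℝ) (j : Jet) :
    canonicalF f j = (Real.cos j.2.2.1)⁻¹ ^ 3 / speedInv j ^ 3 * f := by
  rw [canonicalF, rpow_three_halves]

theorem canonicalF_eq_mul (f : ℝ) (j : Jet) : canonicalF f j = canonicalF 1 j * f := by
  simp only [canonicalF, mul_one]

theorem canonicalG_one_zero (j : Jet) :
    canonicalG 1 0 j = 9 * omegaInv j * tauInv j * Real.tan j.2.2.1
      - 3 * omegaInv j * tauInv j ^ 2 * speedInv j
      + omegaInv j * (1 + 2 * omegaInv j ^ 2) / speedInv j ^ 3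
      - omegaInv j * (5 + 6 * omegaInv j ^ 2) * Real.tan j.2.2.1 ^ 2 / speedInv j ^ 3 := by
  rw [canonicalG, add_comm (omegaInv j ^ 2) 1, rpow_three_halves, ← speedInv]
  ring

/-- Linearity in `f` and `h` isolates the fixed coefficients `canonicalG 1 0` and `speedInv`, so
that each is differentiated only once. -/
theorem canonicalG_eq (f h : ℝ) (j : Jet) :
    canonicalG f h j = canonicalG 1 0 j * f + speedInv j * h := by
  rw [canonicalG, canonicalG, add_comm (omegaInv j ^ 2) 1, ← speedInv]
  ring

theorem inv_cos_sq {y : ℝ} (h : Real.cos y ≠ 0) :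
    (Real.cos y)⁻¹ ^ 2 = 1 + Real.tan y ^ 2 := by
  rw [inv_pow, ← Real.inv_one_add_tan_sq h, inv_inv]

theorem hasDerivAt_inv_cos {y : ℝ} (h : Real.cos y ≠ 0) :
    HasDerivAt (fun y => (Real.cos y)⁻¹) ((Real.cos y)⁻¹ * Real.tan y) y := by
  refine ((Real.hasDerivAt_cos y).fun_inv h).congr_deriv ?_
  rw [Real.tan_eq_sin_div_cos]
  field_simp

theorem hasDerivAt_tan' {y : ℝ} (h : Real.cos y ≠ 0) :
    HasDerivAt Real.tan (1 + Real.tan y ^ 2) y := by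
  convert Real.hasDerivAt_tan h using 1
  rw [← inv_cos_sq h, inv_pow, one_div]

section curves

variable {c : ℝ → Jet} {w : Jet} {e : ℝ}

/-- The invariants are differentiated along a curve `c` with velocity `w`, by one-variable calculus;
a directional derivative on the jet space is recovered by taking a line for `c`. -/
theorem HasDerivAt.jet_components (hc : HasDerivAt c w e) :
    HasDerivAt (fun s => (c s).2.2.1) w.2.2.1 e ∧
    HasDerivAt (fun s => (c s).2.2.2.1) w.2.2.2.1 e ∧
    HasDerivAt (fun s => (c s).2.2.2.2) w.2.2.2.2 e := by
  have h1 : HasDerivAt (fun s => (c s).2.2) w.2.2 e := by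
    have := (((ContinuousLinearMap.snd ℝ ℝ (ℝ × ℝ × ℝ)).comp
      (ContinuousLinearMap.snd ℝ ℝ (ℝ × ℝ × ℝ × ℝ))).hasFDerivAt (x := c e)).comp_hasDerivAt e hc
    exact this
  have h2 := (ContinuousLinearMap.snd ℝ ℝ (ℝ × ℝ)).hasFDerivAt.comp_hasDerivAt e h1
  exact ⟨(ContinuousLinearMap.fst ℝ ℝ (ℝ × ℝ)).hasFDerivAt.comp_hasDerivAt e h1,
    (ContinuousLinearMap.fst ℝ ℝ ℝ).hasFDerivAt.comp_hasDerivAt e h2,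
    (ContinuousLinearMap.snd ℝ ℝ ℝ).hasFDerivAt.comp_hasDerivAt e h2⟩

theorem HasDerivAt.omegaInv (hc : HasDerivAt c w e) (h : Real.cos (c e).2.2.1 ≠ 0) :
    HasDerivAt (fun s => omegaInv (c s))
      ((Real.cos (c e).2.2.1)⁻¹ * (w.2.2.2.1 + (c e).2.2.2.1 * Real.tan (c e).2.2.1 * w.2.2.1))
      e := by
  obtain ⟨h1, h2, -⟩ := hc.jet_components
  refine (h2.fun_mul ((hasDerivAt_inv_cos h).comp e h1)).congr_deriv ?_
  simp only [Function.comp_apply]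
  ring

theorem HasDerivAt.speedInv (hc : HasDerivAt c w e) (h : Real.cos (c e).2.2.1 ≠ 0) :
    HasDerivAt (fun s => speedInv (c s))
      (_root_.omegaInv (c e) / _root_.speedInv (c e) * ((Real.cos (c e).2.2.1)⁻¹ *
        (w.2.2.2.1 + (c e).2.2.2.1 * Real.tan (c e).2.2.1 * w.2.2.1))) e := by
  have h0 := ((hc.omegaInv h).fun_pow 2).const_add 1
  have h1 := h0.sqrt (by positivity)
  simp only [Real.sqrt_eq_rpow] at h1
  refine h1.congr_deriv ?_
  change _ / (2 * _root_.speedInv (c e)) = _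
  have := (speedInv_pos (c e)).ne'
  simp
  field_simp

theorem HasDerivAt.tauInv (hc : HasDerivAt c w e) (h : Real.cos (c e).2.2.1 ≠ 0) :
    HasDerivAt (fun s => tauInv (c s))
      ((w.2.2.2.2 * (Real.cos (c e).2.2.1)⁻¹ ^ 2
        + 2 * (c e).2.2.2.2 * (Real.cos (c e).2.2.1)⁻¹ ^ 2 * Real.tan (c e).2.2.1 * w.2.2.1
        + 4 * _root_.omegaInv (c e) * ((Real.cos (c e).2.2.1)⁻¹ *
        (w.2.2.2.1 + (c e).2.2.2.1 * Real.tan (c e).2.2.1 * w.2.2.1)) * Real.tan (c e).2.2.1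
        + (1 + 2 * _root_.omegaInv (c e) ^ 2) * ((1 + Real.tan (c e).2.2.1 ^ 2) * w.2.2.1))
        / _root_.speedInv (c e) ^ 3
        - 3 * _root_.tauInv (c e) * _root_.omegaInv (c e) / _root_.speedInv (c e) ^ 2
          * ((Real.cos (c e).2.2.1)⁻¹ *
        (w.2.2.2.1 + (c e).2.2.2.1 * Real.tan (c e).2.2.1 * w.2.2.1))) e := by
  obtain ⟨h1, h2, h3⟩ := hc.jet_components
  have hW := (speedInv_pos (c e)).ne'
  have := ((h3.fun_mul (((hasDerivAt_inv_cos h).comp e h1).fun_pow 2)).fun_add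
    (((((hc.omegaInv h).fun_pow 2).const_mul 2).const_add 1).fun_mul
      ((hasDerivAt_tan' h).comp e h1))).fun_div ((hc.speedInv h).fun_pow 3) (by positivity)
  simp only [Function.comp_apply] at this
  simp only [tauInv_eq]
  refine this.congr_deriv ?_
  simp only [Nat.cast_ofNat, Nat.add_one_sub_one, pow_one]
  field_simp
  ring

end curves

/-! ### The prolonged vector fields -/

/-- The total derivative `D_x ξ` for `ξ = α + s(x) tan u`, where `s(x) = σ`, `s'(x) = ρ`. -/
noncomputable def xiOne (σ ρ : ℝ) (j : Jet) : ℝ :=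
  (1 + Real.tan j.2.2.1 ^ 2) * j.2.2.2.1 * σ + Real.tan j.2.2.1 * ρ

/-- The total derivative `D_x² ξ` for `ξ = α + s(x) tan u`, where `s'' = -s`. -/
noncomputable def xiTwo (σ ρ : ℝ) (j : Jet) : ℝ :=
  2 * Real.tan j.2.2.1 * (1 + Real.tan j.2.2.1 ^ 2) * j.2.2.2.1 ^ 2 * σ
    + (1 + Real.tan j.2.2.1 ^ 2) * j.2.2.2.2 * σ
    + 2 * (1 + Real.tan j.2.2.1 ^ 2) * j.2.2.2.1 * ρ - Real.tan j.2.2.1 * σ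

/-- The part of the total derivative `D_x³ ξ` for `ξ = α + s(x) tan u` without `u₃`. -/
noncomputable def xiThree (σ ρ : ℝ) (j : Jet) : ℝ :=
  (2 + 6 * Real.tan j.2.2.1 ^ 2) * (1 + Real.tan j.2.2.1 ^ 2) * j.2.2.2.1 ^ 3 * σ
    + 6 * Real.tan j.2.2.1 * (1 + Real.tan j.2.2.1 ^ 2) * j.2.2.2.1 * j.2.2.2.2 * σ
    + 6 * Real.tan j.2.2.1 * (1 + Real.tan j.2.2.1 ^ 2) * j.2.2.2.1 ^ 2 * ρ
    + 3 * (1 + Real.tan j.2.2.1 ^ 2) * j.2.2.2.2 * ρ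
    - 3 * (1 + Real.tan j.2.2.1 ^ 2) * j.2.2.2.1 * σ - Real.tan j.2.2.1 * ρ

/-- The value at `j` of the second prolongation of `δ ∂_t + (α + s(x) tan u) ∂_x + s'(x) ∂_u`,
where `s'' = -s` and `s(x) = σ`, `s'(x) = ρ`. -/
noncomputable def prolonged (δ α σ ρ : ℝ) (j : Jet) : Jet :=
  (δ, α + Real.tan j.2.2.1 * σ, ρ, -σ - j.2.2.2.1 * xiOne σ ρ j,
    -ρ - 2 * j.2.2.2.2 * xiOne σ ρ j - j.2.2.2.1 * xiTwo σ ρ j)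

/-- The part without `u₃` of the `u₃`-coefficient of the prolongation. -/
noncomputable def prolongedThree (σ ρ : ℝ) (j : Jet) : ℝ :=
  σ - 3 * j.2.2.2.2 * xiTwo σ ρ j - j.2.2.2.1 * xiThree σ ρ j

section prolonged

variable {c : ℝ → Jet} {e δ α σ ρ : ℝ}

/-- The left side is the derivative of `ω` along the prolonged field, as it occurs in the
derivatives of `speedInv` and `tauInv`. -/
theorem tan_mul_inv_cos_aux {j : Jet} (h : Real.cos j.2.2.1 ≠ 0) :
    (Real.cos j.2.2.1)⁻¹ * ((prolonged δ α σ ρ j).2.2.2.1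
      + j.2.2.2.1 * Real.tan j.2.2.1 * (prolonged δ α σ ρ j).2.2.1)
      = -((Real.cos j.2.2.1)⁻¹ * σ * speedInv j ^ 2) := by
  rw [speedInv_sq]
  simp only [prolonged, xiOne, omegaInv, mul_pow, inv_cos_sq h]
  ring

/-- The factor `-u₁ ξ_u`, with `ξ = α + σ tan u`, is the one that multiplies `G` in its determining
equation. Hence `speedInv` times a function of `τ` solves the homogeneous part. -/
theorem HasDerivAt.speedInv_prolonged (hc : HasDerivAt c (prolonged δ α σ ρ (c e)) e)
    (h : Real.cos (c e).2.2.1 ≠ 0) :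
    HasDerivAt (fun s => _root_.speedInv (c s))
      (-((1 + Real.tan (c e).2.2.1 ^ 2) * (c e).2.2.2.1 * σ * _root_.speedInv (c e))) e := by
  refine (hc.speedInv h).congr_deriv ?_
  rw [tan_mul_inv_cos_aux h, ← inv_cos_sq h, _root_.omegaInv]
  have := (speedInv_pos (c e)).ne'
  field_simp

/-- Geodesic curvature is invariant under rotations, and `τ` involves neither `t` nor `x`. -/
theorem HasDerivAt.tauInv_prolonged (hc : HasDerivAt c (prolonged δ α σ ρ (c e)) e)
    (h : Real.cos (c e).2.2.1 ≠ 0) :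
    HasDerivAt (fun s => _root_.tauInv (c s)) 0 e := by
  refine (hc.tauInv h).congr_deriv ?_
  have hW := (speedInv_pos (c e)).ne'
  rw [tan_mul_inv_cos_aux h, tauInv_eq]
  -- Only in this term must `speedInv ^ 2` be expanded; the other powers cancel.
  have h4 : 4 * _root_.omegaInv (c e) * -((Real.cos (c e).2.2.1)⁻¹ * σ * _root_.speedInv (c e) ^ 2)
      = 4 * _root_.omegaInv (c e) * -((Real.cos (c e).2.2.1)⁻¹ * σ
        * (1 + _root_.omegaInv (c e) ^ 2)) := by rw [speedInv_sq]
  rw [h4]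
  simp only [prolonged, xiOne, xiTwo, _root_.omegaInv, ← inv_cos_sq h]
  field_simp
  ring

/-- The logarithmic derivatives of `sec u` and `speedInv` are `ρ tan u` and `-u₁ σ sec² u`. Their
difference is `D_x ξ`, and the quotient enters cubed. -/
theorem HasDerivAt.canonicalF_prolonged (hc : HasDerivAt c (prolonged δ α σ ρ (c e)) e)
    (h : Real.cos (c e).2.2.1 ≠ 0) :
    HasDerivAt (fun s => canonicalF 1 (c s)) (3 * xiOne σ ρ (c e) * canonicalF 1 (c e)) e := by
  obtain ⟨h1, -, -⟩ := hc.jet_components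
  have hW := (speedInv_pos (c e)).ne'
  simp only [canonicalF_eq, mul_one]
  refine ((((hasDerivAt_inv_cos h).comp e h1).fun_pow 3).fun_div
    ((hc.speedInv_prolonged h).fun_pow 3) (by positivity)).congr_deriv ?_
  simp only [Function.comp_apply, prolonged, xiOne]
  simp
  field_simp
  ring

/-- A particular solution of the inhomogeneous equation for `G` that belongs to `F = canonicalF 1`.
-/
theorem HasDerivAt.canonicalG_prolonged (hc : HasDerivAt c (prolonged δ α σ ρ (c e)) e)
    (h : Real.cos (c e).2.2.1 ≠ 0) :
    HasDerivAt (fun s => canonicalG 1 0 (c s))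
      (-((1 + Real.tan (c e).2.2.1 ^ 2) * (c e).2.2.2.1 * σ * canonicalG 1 0 (c e))
        - prolongedThree σ ρ (c e) * canonicalF 1 (c e)) e := by
  obtain ⟨h1, -, -⟩ := hc.jet_components
  have hW := (speedInv_pos (c e)).ne'
  have hT := (hasDerivAt_tan' h).comp e h1
  have hO := hc.omegaInv h
  rw [tan_mul_inv_cos_aux h] at hO
  have hτ := hc.tauInv_prolonged h
  have hV := hc.speedInv_prolonged h
  have H := ((((hO.const_mul 9).fun_mul hτ).fun_mul hT).fun_sub
    (((hO.const_mul 3).fun_mul (hτ.fun_pow 2)).fun_mul hV)).fun_add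
    ((hO.fun_mul (((hO.fun_pow 2).const_mul 2).const_add 1)).fun_div (hV.fun_pow 3)
      (by positivity)) |>.fun_sub
    (((hO.fun_mul (((hO.fun_pow 2).const_mul 6).const_add 5)).fun_mul (hT.fun_pow 2)).fun_div
      (hV.fun_pow 3) (by positivity))
  simp only [canonicalG_one_zero]
  refine H.congr_deriv ?_
  have hu : (c e).2.2.2.2 * (Real.cos (c e).2.2.1)⁻¹ ^ 2
      = _root_.tauInv (c e) * _root_.speedInv (c e) ^ 3
        - (1 + 2 * _root_.omegaInv (c e) ^ 2) * Real.tan (c e).2.2.1 := by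
    rw [tauInv_eq]; field_simp; ring
  have h2 : (c e).2.2.2.1 * (Real.cos (c e).2.2.1)⁻¹ = _root_.omegaInv (c e) := rfl
  have hW2 := speedInv_sq (c e)
  simp only [canonicalF_eq, Function.comp_apply, prolonged, prolongedThree, xiTwo, xiThree,
    ← inv_cos_sq h]
  simp only [mul_zero, mul_one, Nat.cast_ofNat, Nat.add_one_sub_one, pow_one]
  have hS : (Real.cos (c e).2.2.1)⁻¹ ≠ 0 := inv_ne_zero h
  have hTS := inv_cos_sq h
  generalize (c e).2.2.2.2 = b at *
  generalize (c e).2.2.2.1 = a at *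
  generalize Real.tan (c e).2.2.1 = T at *
  generalize _root_.speedInv (c e) = W at *
  generalize _root_.omegaInv (c e) = O at *
  generalize _root_.tauInv (c e) = τ at *
  generalize (Real.cos (c e).2.2.1)⁻¹ = S at *
  -- With `u₁` and `u₂` expressed through `ω` and `τ`, a polynomial identity remains, to be checked
  -- modulo `ω² = W² - 1` and `tan² u = sec² u - 1`.
  obtain rfl : a = O / S := by rw [← h2]; field_simp
  obtain rfl : b = (τ * W ^ 3 - (1 + 2 * O ^ 2) * T) / S ^ 2 := by rw [← hu]; field_simp
  have hO2 : O ^ 2 = W ^ 2 - 1 := by rw [hW2]; ring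
  have hO3 : O ^ 3 = O * (W ^ 2 - 1) := by rw [← hO2]; ring
  have hO4 : O ^ 4 = (W ^ 2 - 1) ^ 2 := by rw [← hO2]; ring
  have hT2 : T ^ 2 = S ^ 2 - 1 := by rw [hTS]; ring
  clear hu h2 hW2 hTS
  field_simp
  ring_nf
  simp only [hO2, hO3, hO4, hT2]
  ring

end prolonged

/-! ### Smoothness of the invariants -/

section smooth

variable {j : Jet}

theorem contDiffAt_omegaInv (h : Real.cos j.2.2.1 ≠ 0) : ContDiffAt ℝ ∞ omegaInv j :=
  ContDiffAt.mul (by fun_prop) (ContDiffAt.inv (by fun_prop) h)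

theorem contDiffAt_tan_jet (h : Real.cos j.2.2.1 ≠ 0) :
    ContDiffAt ℝ ∞ (fun j : Jet => Real.tan j.2.2.1) j :=
  ContDiffAt.comp (f := fun j : Jet => j.2.2.1) j (Real.contDiffAt_tan.2 h) (by fun_prop)

theorem contDiffAt_speedInv (h : Real.cos j.2.2.1 ≠ 0) : ContDiffAt ℝ ∞ speedInv j :=
  ContDiffAt.rpow_const_of_ne (contDiffAt_const.add ((contDiffAt_omegaInv h).pow 2))
    (by positivity)

theorem contDiffAt_tauInv (h : Real.cos j.2.2.1 ≠ 0) : ContDiffAt ℝ ∞ tauInv j := by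
  have ho := contDiffAt_omegaInv h
  have hW := contDiffAt_speedInv h
  have hT := contDiffAt_tan_jet h
  have hc : ContDiffAt ℝ ∞ (fun j : Jet => (Real.cos j.2.2.1)⁻¹) j :=
    ContDiffAt.inv (by fun_prop) h
  rw [show tauInv = _ from funext tauInv_eq]
  refine ContDiffAt.div ?_ (hW.pow 3) (pow_ne_zero _ (speedInv_pos j).ne')
  fun_prop

theorem contDiffAt_canonicalF (f : ℝ) (h : Real.cos j.2.2.1 ≠ 0) :
    ContDiffAt ℝ ∞ (canonicalF f) j := by
  have hW := contDiffAt_speedInv h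
  have hc : ContDiffAt ℝ ∞ (fun j : Jet => (Real.cos j.2.2.1)⁻¹) j :=
    ContDiffAt.inv (by fun_prop) h
  rw [show canonicalF f = _ from funext (canonicalF_eq f)]
  exact ((hc.pow 3).div (hW.pow 3) (pow_ne_zero _ (speedInv_pos j).ne')).mul contDiffAt_const

theorem contDiffAt_canonicalG (h : Real.cos j.2.2.1 ≠ 0) :
    ContDiffAt ℝ ∞ (canonicalG 1 0) j := by
  have ho := contDiffAt_omegaInv h
  have hW := contDiffAt_speedInv h
  have hT := contDiffAt_tan_jet h
  have hτ := contDiffAt_tauInv h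
  have hW' : speedInv j ^ 3 ≠ 0 := pow_ne_zero _ (speedInv_pos j).ne'
  rw [show canonicalG 1 0 = _ from funext canonicalG_one_zero]
  refine ContDiffAt.sub (ContDiffAt.add (by fun_prop) (ContDiffAt.div ?_ (hW.pow 3) hW'))
    (ContDiffAt.div ?_ (hW.pow 3) hW') <;> fun_prop

theorem canonicalF_ne_zero {f : ℝ} (hf : f ≠ 0) (h : Real.cos j.2.2.1 ≠ 0) :
    canonicalF f j ≠ 0 := by
  rw [canonicalF_eq]
  have := (speedInv_pos j).ne'
  positivity

end smooth

/-- The prolonged vector fields span the kernel of the differential of `τ`. -/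
theorem exists_prolonged_of_hasDerivAt_tauInv {c : ℝ → Jet} {w : Jet} {e : ℝ}
    (hc : HasDerivAt c w e) (h : Real.cos (c e).2.2.1 ≠ 0)
    (hτ : HasDerivAt (fun s => tauInv (c s)) 0 e) :
    ∃ δ α σ ρ, w = prolonged δ α σ ρ (c e) := by
  obtain ⟨w1, w2, w3, w4, w5⟩ := w
  have hW : 1 + omegaInv (c e) ^ 2 ≠ 0 := by positivity
  have hO : omegaInv (c e) ^ 2 = (c e).2.2.2.1 ^ 2 * (1 + Real.tan (c e).2.2.1 ^ 2) := by
    rw [omegaInv, mul_pow, inv_cos_sq h]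
  -- The first and third components give `δ` and `ρ`, the fourth is solved for `σ` because its
  -- coefficient `1 + ω²` has no zero, and the second then gives `α`.
  obtain ⟨σ, hσ⟩ : ∃ σ, σ * (1 + omegaInv (c e) ^ 2)
      = -(w4 + (c e).2.2.2.1 * Real.tan (c e).2.2.1 * w3) :=
    ⟨-(w4 + (c e).2.2.2.1 * Real.tan (c e).2.2.1 * w3) / (1 + omegaInv (c e) ^ 2), by field_simp⟩
  refine ⟨w1, w2 - Real.tan (c e).2.2.1 * σ, σ, w3, ?_⟩
  have h4 : w4 = -σ - (c e).2.2.2.1 * xiOne σ w3 (c e) := by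
    rw [hO] at hσ
    rw [xiOne]
    linarith
  have h5 : w5 = -w3 - 2 * (c e).2.2.2.2 * xiOne σ w3 (c e) - (c e).2.2.2.1 * xiTwo σ w3 (c e) := by
    -- The prolonged vector also lies in the kernel of `dτ`, and `∂τ/∂u₂ = sec² u / speedInv³ ≠ 0`,
    -- so the fifth components agree. The value of `α` affects only the `x`-component, which `dτ`
    -- ignores.
    obtain ⟨l, hl, he⟩ : ∃ l : ℝ → Jet, HasDerivAt l (prolonged w1 0 σ w3 (c e)) e ∧ l e = c e :=
      ⟨fun s => c e + (s - e) • prolonged w1 0 σ w3 (c e), by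
        simpa using (((hasDerivAt_id e).sub_const e).smul_const
          (prolonged w1 0 σ w3 (c e))).const_add (c e), by simp⟩
    rw [← he] at h hl
    have h2 := (hl.tauInv_prolonged h).unique (hl.tauInv h)
    rw [he] at h h2
    have h3 := hτ.unique (hc.tauInv h)
    simp only [prolonged] at h2 h3
    rw [h2, h4] at h3
    have hS : (Real.cos (c e).2.2.1)⁻¹ ≠ 0 := inv_ne_zero h
    have hV := (speedInv_pos (c e)).ne'
    field_simp at h3
    linarith
  simp only [prolonged, ← h4, ← h5, sub_add_cancel]

/-! ### Prolongation formulas -/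

/-- The formulas for the characteristic hold only near `x`, where the graph stays over the domain of
the field, so derivatives are iterated on germs. -/
theorem deriv_eventuallyEq {c f f' : ℝ → ℝ} {x : ℝ} (hc : c =ᶠ[𝓝 x] f)
    (hf : ∀ᶠ y in 𝓝 x, HasDerivAt f (f' y) y) : deriv c =ᶠ[𝓝 x] f' := by
  filter_upwards [hc.eventuallyEq_nhds, hf] with y h1 h2
  rw [h1.deriv_eq, h2.deriv]

/-- The prolongation of `δ ∂_t + (α + s(x) tan u) ∂_x + r(x) ∂_u`, where `s' = r` and `r' = -s`,
in terms of its characteristic `c` along a curve. -/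
theorem deriv_characteristic_curve {v₀ v₁ v₂ v₃ v₄ g₀ g₁ g₂ g₃ s r c : ℝ → ℝ} {δ α t x : ℝ}
    (h₀ : ∀ y, HasDerivAt v₀ (v₁ y) y) (h₁ : ∀ y, HasDerivAt v₁ (v₂ y) y)
    (h₂ : ∀ y, HasDerivAt v₂ (v₃ y) y) (h₃ : ∀ y, HasDerivAt v₃ (v₄ y) y)
    (k₀ : ∀ y, HasDerivAt g₀ (g₁ y) y) (k₁ : ∀ y, HasDerivAt g₁ (g₂ y) y)
    (k₂ : ∀ y, HasDerivAt g₂ (g₃ y) y)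
    (hs : ∀ y, HasDerivAt s (r y) y) (hr : ∀ y, HasDerivAt r (-s y) y)
    (hx : Real.cos (v₀ x) ≠ 0)
    (hc : c =ᶠ[𝓝 x] fun y => r y - g₀ y * δ - v₁ y * (α + Real.tan (v₀ y) * s y)) :
    deriv c x + g₁ x * δ + v₂ x * (α + Real.tan (v₀ x) * s x)
      = -s x - v₁ x * xiOne (s x) (r x) (t, x, v₀ x, v₁ x, v₂ x) ∧
    deriv (deriv c) x + g₂ x * δ + v₃ x * (α + Real.tan (v₀ x) * s x)
      = -r x - 2 * v₂ x * xiOne (s x) (r x) (t, x, v₀ x, v₁ x, v₂ x)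
        - v₁ x * xiTwo (s x) (r x) (t, x, v₀ x, v₁ x, v₂ x) ∧
    deriv (deriv (deriv c)) x + g₃ x * δ + v₄ x * (α + Real.tan (v₀ x) * s x)
      = prolongedThree (s x) (r x) (t, x, v₀ x, v₁ x, v₂ x)
        - (3 * xiOne (s x) (r x) (t, x, v₀ x, v₁ x, v₂ x)
          + v₁ x * (1 + Real.tan (v₀ x) ^ 2) * s x) * v₃ x := by
  have hcos : ∀ᶠ y in 𝓝 x, Real.cos (v₀ y) ≠ 0 :=
    (Real.continuous_cos.continuousAt.comp (h₀ x).continuousAt).eventually_ne hx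
  have hT : ∀ᶠ y in 𝓝 x, HasDerivAt (fun y => Real.tan (v₀ y))
      ((1 + Real.tan (v₀ y) ^ 2) * v₁ y) y := by
    filter_upwards [hcos] with y hy using (hasDerivAt_tan' hy).comp y (h₀ y)
  have hξ : ∀ᶠ y in 𝓝 x, HasDerivAt (fun y => α + Real.tan (v₀ y) * s y)
      (xiOne (s y) (r y) (t, y, v₀ y, v₁ y, v₂ y)) y := by
    filter_upwards [hT] with y hy
    refine ((hy.fun_mul (hs y)).const_add α).congr_deriv ?_
    simp only [xiOne]
  have hξ₁ : ∀ᶠ y in 𝓝 x, HasDerivAt (fun y => xiOne (s y) (r y) (t, y, v₀ y, v₁ y, v₂ y))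
      (xiTwo (s y) (r y) (t, y, v₀ y, v₁ y, v₂ y)) y := by
    filter_upwards [hT] with y hy
    refine ((((((hy.fun_pow 2).const_add 1).fun_mul (h₁ y)).fun_mul (hs y))).fun_add
      (hy.fun_mul (hr y))).congr_deriv ?_
    simp only [xiTwo]
    push_cast
    ring
  have hξ₂ : ∀ᶠ y in 𝓝 x, HasDerivAt (fun y => xiTwo (s y) (r y) (t, y, v₀ y, v₁ y, v₂ y))
      (xiThree (s y) (r y) (t, y, v₀ y, v₁ y, v₂ y)
        + (1 + Real.tan (v₀ y) ^ 2) * v₃ y * s y) y := by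
    filter_upwards [hT] with y hy
    have hq := (hy.fun_pow 2).const_add 1
    refine ((((((hy.const_mul 2).fun_mul hq).fun_mul ((h₁ y).fun_pow 2)).fun_mul (hs y)).fun_add
      ((hq.fun_mul (h₂ y)).fun_mul (hs y))).fun_add
      (((hq.const_mul 2).fun_mul (h₁ y)).fun_mul (hr y)) |>.fun_sub
      (hy.fun_mul (hs y))).congr_deriv ?_
    simp only [xiThree]
    push_cast
    ring
  -- Every derivative of the characteristic contains the terms `-δ g_k` and `-ξ v_{k+1}`; these are
  -- what the prolongation coefficient cancels.
  have e₁ := deriv_eventuallyEq (f' := fun y => -s y - g₁ y * δ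
      - v₂ y * (α + Real.tan (v₀ y) * s y) - v₁ y * xiOne (s y) (r y) (t, y, v₀ y, v₁ y, v₂ y)) hc
    (by
      filter_upwards [hξ] with y hy
      refine (((hr y).fun_sub ((k₀ y).mul_const δ)).fun_sub ((h₁ y).fun_mul hy)).congr_deriv ?_
      ring)
  have e₂ := deriv_eventuallyEq (f' := fun y => -r y - g₂ y * δ
      - v₃ y * (α + Real.tan (v₀ y) * s y)
      - 2 * v₂ y * xiOne (s y) (r y) (t, y, v₀ y, v₁ y, v₂ y)
      - v₁ y * xiTwo (s y) (r y) (t, y, v₀ y, v₁ y, v₂ y)) e₁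
    (by
      filter_upwards [hξ, hξ₁] with y hy hy₁
      refine ((((hs y).fun_neg.fun_sub ((k₁ y).mul_const δ)).fun_sub
        ((h₂ y).fun_mul hy)).fun_sub ((h₁ y).fun_mul hy₁)).congr_deriv ?_
      ring)
  have e₃ : HasDerivAt (deriv (deriv c)) (s x - g₃ x * δ
      - v₄ x * (α + Real.tan (v₀ x) * s x)
      - 3 * v₃ x * xiOne (s x) (r x) (t, x, v₀ x, v₁ x, v₂ x)
      - 3 * v₂ x * xiTwo (s x) (r x) (t, x, v₀ x, v₁ x, v₂ x)
      - v₁ x * (xiThree (s x) (r x) (t, x, v₀ x, v₁ x, v₂ x)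
        + (1 + Real.tan (v₀ x) ^ 2) * v₃ x * s x)) x := by
    refine HasDerivAt.congr_of_eventuallyEq ?_ e₂
    refine (((((hr x).fun_neg.fun_sub ((k₂ x).mul_const δ)).fun_sub
      ((h₃ x).fun_mul hξ.self_of_nhds)).fun_sub
      (((h₂ x).const_mul 2).fun_mul hξ₁.self_of_nhds)).fun_sub
      ((h₁ x).fun_mul hξ₂.self_of_nhds)).congr_deriv ?_
    ring
  refine ⟨?_, ?_, ?_⟩
  · rw [e₁.eq_of_nhds]
    ring
  · rw [e₂.eq_of_nhds]
    ring
  · rw [e₃.deriv, prolongedThree]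
    ring

/-! ### Partial derivatives of smooth functions of `(t, x)` -/

section smooth

variable {w : ℝ → ℝ → ℝ}

theorem dX_eq_fderiv (hw : ContDiff ℝ ∞ fun q : ℝ × ℝ => w q.1 q.2) (t x : ℝ) :
    dX w t x = fderiv ℝ (fun q : ℝ × ℝ => w q.1 q.2) (t, x) (0, 1) := by
  have h := (hw.differentiable (by simp) (t, x)).hasFDerivAt.comp_hasDerivAt x
    ((hasDerivAt_const x t).prodMk (hasDerivAt_id x))
  exact h.deriv

theorem dT_eq_fderiv (hw : ContDiff ℝ ∞ fun q : ℝ × ℝ => w q.1 q.2) (t x : ℝ) :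
    dT w t x = fderiv ℝ (fun q : ℝ × ℝ => w q.1 q.2) (t, x) (1, 0) := by
  have h := (hw.differentiable (by simp) (t, x)).hasFDerivAt.comp_hasDerivAt t
    ((hasDerivAt_id t).prodMk (hasDerivAt_const t x))
  exact h.deriv

theorem contDiff_dX (hw : ContDiff ℝ ∞ fun q : ℝ × ℝ => w q.1 q.2) :
    ContDiff ℝ ∞ fun q : ℝ × ℝ => dX w q.1 q.2 := by
  simp only [dX_eq_fderiv hw]
  exact (hw.fderiv_right (by simp)).clm_apply contDiff_const

theorem contDiff_dT (hw : ContDiff ℝ ∞ fun q : ℝ × ℝ => w q.1 q.2) :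
    ContDiff ℝ ∞ fun q : ℝ × ℝ => dT w q.1 q.2 := by
  simp only [dT_eq_fderiv hw]
  exact (hw.fderiv_right (by simp)).clm_apply contDiff_const

theorem hasDerivAt_dX (hw : ContDiff ℝ ∞ fun q : ℝ × ℝ => w q.1 q.2) (t x : ℝ) :
    HasDerivAt (w t) (dX w t x) x := by
  have h : Differentiable ℝ (w t) :=
    (hw.comp (contDiff_const.prodMk contDiff_id)).differentiable (by simp)
  exact (h x).hasDerivAt

theorem hasDerivAt_dT (hw : ContDiff ℝ ∞ fun q : ℝ × ℝ => w q.1 q.2) (t x : ℝ) :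
    HasDerivAt (fun s => w s x) (dT w t x) t := by
  have h : Differentiable ℝ (fun s => w s x) :=
    (hw.comp (contDiff_id.prodMk contDiff_const)).differentiable (by simp)
  exact (h t).hasDerivAt

end smooth

/-! ### The infinitesimal symmetry criterion -/

section symmetry

variable {Ω : TopologicalSpace.Opens Jet}

theorem proj_mem_base {j : Jet} (hj : j ∈ Ω) : proj j ∈ base Ω := ⟨j, hj, rfl⟩

/-- The vector field `a(t) ∂_t + (α + s(x) tan u) ∂_x + s'(x) ∂_u` with
`s(x) = β sin x + γ cos x`. -/
noncomputable def fieldForm (a : ℝ → ℝ) (α β γ : ℝ) (p : Point) : Point :=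
  (a p.1, α + Real.tan p.2.2 * (β * Real.sin p.2.1 + γ * Real.cos p.2.1),
    β * Real.cos p.2.1 - γ * Real.sin p.2.1)

variable {a : ℝ → ℝ} {α β γ : ℝ}

/-- Nothing is assumed about `a` itself; its smoothness is inherited from `Q` restricted to the line
through `p` parallel to the `t`-axis. -/
theorem contDiffAt_of_fieldForm {M : TopologicalSpace.Opens Point} {Q : VField M}
    (hQ : ∀ p ∈ M, Q.1 p = fieldForm a α β γ p) {p : Point} (hp : p ∈ M) :
    ContDiffAt ℝ ∞ a p.1 := by
  have h1 : ContDiffAt ℝ ∞ (fun s : ℝ => (s, p.2)) p.1 := by fun_prop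
  have h2 : ContDiffAt ℝ ∞ (fun s : ℝ => (Q.1 (s, p.2)).1) p.1 :=
    (ContDiffAt.comp p.1 (Q.contDiffAt (p := (p.1, p.2)) hp) h1).fst
  refine h2.congr_of_eventuallyEq ?_
  filter_upwards [h1.continuousAt.eventually (M.isOpen.mem_nhds (x := (p.1, p.2)) hp)] with s hs
  rw [hQ _ hs, fieldForm]

/-- Since `a` depends on `t` only, the mixed derivatives `u_tx`, `u_txx`, `u_txxx` drop out, and so
do `u_tt` and the fourth `x`-derivative. What remains involves the second-order jet, `u_t` and `u₃`
only. -/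
theorem prolongDelta_eq (hcos : CosNeZero (base Ω)) (E : EvolutionEquation Ω)
    {Q : VField (base Ω)} (hQ : ∀ p ∈ base Ω, Q.1 p = fieldForm a α β γ p)
    {v : ℝ → ℝ → ℝ} (hv : ContDiff ℝ ∞ fun q : ℝ × ℝ => v q.1 q.2) {t x : ℝ}
    (hj : jetOf v t x ∈ Ω) {σ ρ : ℝ} (hσ : σ = β * Real.sin x + γ * Real.cos x)
    (hρ : ρ = β * Real.cos x - γ * Real.sin x) :
    E.prolongDelta Q.1 v t x =
      -(deriv a t * dT v t x)
        - (1 + Real.tan (jetOf v t x).2.2.1 ^ 2) * (jetOf v t x).2.2.2.1 * σ * dT v t x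
      - fderiv ℝ E.F (jetOf v t x) (prolonged (a t) α σ ρ (jetOf v t x)) * dX (dX (dX v)) t x
      - E.F (jetOf v t x) * (prolongedThree σ ρ (jetOf v t x)
        - (3 * xiOne σ ρ (jetOf v t x)
          + (jetOf v t x).2.2.2.1 * (1 + Real.tan (jetOf v t x).2.2.1 ^ 2) * σ)
            * dX (dX (dX v)) t x)
      - fderiv ℝ E.G (jetOf v t x) (prolonged (a t) α σ ρ (jetOf v t x)) := by
  have hp : (t, x, v t x) ∈ base Ω := proj_mem_base hj
  have hv₁ := contDiff_dX hv
  have hv₂ := contDiff_dX hv₁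
  have hv₃ := contDiff_dX hv₂
  have hg := contDiff_dT hv
  have hg₁ := contDiff_dX hg
  have hg₂ := contDiff_dX hg₁
  have hvc : Continuous fun q : ℝ × ℝ => v q.1 q.2 := hv.continuous
  have hmem : ∀ᶠ q : ℝ × ℝ in 𝓝 (t, x), (q.1, q.2, v q.1 q.2) ∈ base Ω := by
    have : Continuous fun q : ℝ × ℝ => ((q.1, q.2, v q.1 q.2) : Point) := by fun_prop
    exact this.continuousAt.eventually ((base Ω).isOpen.mem_nhds hp)
  have hX : ∀ᶠ y in 𝓝 x, (t, y, v t y) ∈ base Ω :=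
    (Continuous.prodMk_right t).continuousAt.eventually hmem
  have hT : ∀ᶠ s in 𝓝 t, (s, x, v s x) ∈ base Ω :=
    (Continuous.prodMk_left x).continuousAt.eventually hmem
  have hcx : Real.cos (v t x) ≠ 0 := hcos _ hp
  obtain ⟨P₁, P₂, P₃⟩ := deriv_characteristic_curve (t := t) (α := α) (δ := a t)
    (c := characteristic Q.1 v t) (s := fun x => β * Real.sin x + γ * Real.cos x)
    (r := fun x => β * Real.cos x - γ * Real.sin x)
    (hasDerivAt_dX hv t) (hasDerivAt_dX hv₁ t) (hasDerivAt_dX hv₂ t) (hasDerivAt_dX hv₃ t)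
    (hasDerivAt_dX hg t) (hasDerivAt_dX hg₁ t) (hasDerivAt_dX hg₂ t)
    (fun y => (((Real.hasDerivAt_sin y).const_mul β).fun_add
      ((Real.hasDerivAt_cos y).const_mul γ)).congr_deriv (by ring))
    (fun y => (((Real.hasDerivAt_cos y).const_mul β).fun_sub
      ((Real.hasDerivAt_sin y).const_mul γ)).congr_deriv (by ring)) hcx
    (by
      filter_upwards [hX] with y hy
      simp only [characteristic, hQ _ hy, fieldForm])
  simp only [← hσ, ← hρ] at P₁ P₂ P₃
  have hQx := hQ _ hp
  simp only [fieldForm, ← hσ, ← hρ] at hQx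
  have C₁ : prolongCoeff dX Q.1 v t x = -σ - dX v t x * xiOne σ ρ (jetOf v t x) := by
    rw [prolongCoeff, hQx]
    exact P₁
  have C₂ : prolongCoeff (fun w => dX (dX w)) Q.1 v t x
      = -ρ - 2 * dX (dX v) t x * xiOne σ ρ (jetOf v t x)
        - dX v t x * xiTwo σ ρ (jetOf v t x) := by
    rw [prolongCoeff, hQx]
    exact P₂
  have C₃ : prolongCoeff (fun w => dX (dX (dX w))) Q.1 v t x
      = prolongedThree σ ρ (jetOf v t x) - (3 * xiOne σ ρ (jetOf v t x)
          + dX v t x * (1 + Real.tan (v t x) ^ 2) * σ) * dX (dX (dX v)) t x := by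
    rw [prolongCoeff, hQx]
    exact P₃
  have hvec : prolongVec Q.1 v t x = prolonged (a t) α σ ρ (jetOf v t x) := by
    rw [prolongVec, C₁, C₂, hQx]
    rfl
  have ha : HasDerivAt a (deriv a t) t :=
    ((contDiffAt_of_fieldForm hQ hp).differentiableAt (by simp)).hasDerivAt
  have hchar : HasDerivAt (fun s => characteristic Q.1 v s x)
      (0 - (dT (dT v) t x * a t + dT v t x * deriv a t)
        - (dT (dX v) t x * (α + Real.tan (v t x) * σ)
          + dX v t x * ((1 + Real.tan (v t x) ^ 2) * dT v t x * σ))) t := by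
    have h1 := (((hasDerivAt_const t ρ).fun_sub ((hasDerivAt_dT hg t x).fun_mul ha)).fun_sub
      ((hasDerivAt_dT hv₁ t x).fun_mul ((((hasDerivAt_tan' hcx).comp t
        (hasDerivAt_dT hv t x)).mul_const σ).const_add α)))
    refine h1.congr_of_eventuallyEq ?_
    filter_upwards [hT] with s hs
    simp only [characteristic, hQ _ hs, fieldForm, ← hσ, ← hρ, Function.comp_apply]
  have C₀ : prolongCoeff dT Q.1 v t x = -(deriv a t * dT v t x)
      - (1 + Real.tan (v t x) ^ 2) * dX v t x * σ * dT v t x := by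
    rw [prolongCoeff, hQx]
    simp only [dT] at hchar ⊢
    rw [hchar.deriv]
    ring
  rw [EvolutionEquation.prolongDelta, C₀, C₃, hvec]
  rfl

/-- The polynomial with a given jet and given derivatives `u_t`, `u₃` at a point. -/
noncomputable def jetPolynomial (j : Jet) (u₃ uT t x : ℝ) : ℝ :=
  j.2.2.1 + j.2.2.2.1 * (x - j.2.1) + j.2.2.2.2 / 2 * (x - j.2.1) ^ 2
    + u₃ / 6 * (x - j.2.1) ^ 3 + uT * (t - j.1)

theorem contDiff_jetPolynomial (j : Jet) (u₃ uT : ℝ) :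
    ContDiff ℝ ∞ fun q : ℝ × ℝ => jetPolynomial j u₃ uT q.1 q.2 := by
  unfold jetPolynomial
  fun_prop

theorem jetPolynomial_derivs (j : Jet) (u₃ uT : ℝ) :
    jetOf (jetPolynomial j u₃ uT) j.1 j.2.1 = j ∧
      dX (dX (dX (jetPolynomial j u₃ uT))) j.1 j.2.1 = u₃ ∧
      dT (jetPolynomial j u₃ uT) j.1 j.2.1 = uT := by
  have hl : ∀ x, HasDerivAt (fun x => x - j.2.1) 1 x := fun x => (hasDerivAt_id x).sub_const _
  have h1 : dX (jetPolynomial j u₃ uT) = fun t x =>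
      j.2.2.2.1 + j.2.2.2.2 * (x - j.2.1) + u₃ / 2 * (x - j.2.1) ^ 2 := by
    funext t x
    refine HasDerivAt.deriv ?_
    refine ((((((hl x).const_mul j.2.2.2.1).const_add j.2.2.1).fun_add
      (((hl x).fun_pow 2).const_mul (j.2.2.2.2 / 2))).fun_add
      (((hl x).fun_pow 3).const_mul (u₃ / 6))).add_const (uT * (t - j.1))).congr_deriv ?_
    push_cast
    ring
  have h2 : dX (dX (jetPolynomial j u₃ uT)) = fun t x =>
      j.2.2.2.2 + u₃ * (x - j.2.1) := by
    rw [h1]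
    funext t x
    refine HasDerivAt.deriv ?_
    refine (((((hl x).const_mul j.2.2.2.2).const_add j.2.2.2.1)).fun_add
      (((hl x).fun_pow 2).const_mul (u₃ / 2))).congr_deriv ?_
    push_cast
    ring
  have h3 : dX (dX (dX (jetPolynomial j u₃ uT))) = fun t x => u₃ := by
    rw [h2]
    funext t x
    refine HasDerivAt.deriv ?_
    exact (((hl x).const_mul u₃).const_add j.2.2.2.2).congr_deriv (by ring)
  refine ⟨?_, by rw [h3], ?_⟩
  · rw [jetOf, h2, h1]
    simp [jetPolynomial]
  · refine HasDerivAt.deriv ?_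
    exact ((((hasDerivAt_id j.1).sub_const j.1).const_mul uT).const_add _).congr_deriv (by ring)

/-- After `u_t = F u₃ + G` is substituted, the condition is affine in `u₃`, which is arbitrary; its
two coefficients are the two equations. -/
theorem isSymmetry_iff (hcos : CosNeZero (base Ω)) (E : EvolutionEquation Ω)
    {Q : VField (base Ω)} (hQ : ∀ p ∈ base Ω, Q.1 p = fieldForm a α β γ p) :
    E.IsSymmetry Q ↔ ∀ j ∈ Ω, ∀ σ ρ : ℝ, σ = β * Real.sin j.2.1 + γ * Real.cos j.2.1 →
      ρ = β * Real.cos j.2.1 - γ * Real.sin j.2.1 →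
      fderiv ℝ E.F j (prolonged (a j.1) α σ ρ j) = (3 * xiOne σ ρ j - deriv a j.1) * E.F j ∧
      fderiv ℝ E.G j (prolonged (a j.1) α σ ρ j)
        = -((1 + Real.tan j.2.2.1 ^ 2) * j.2.2.2.1 * σ * E.G j)
          - prolongedThree σ ρ j * E.F j - deriv a j.1 * E.G j := by
  constructor
  · intro h j hj σ ρ hσ hρ
    have key : ∀ u₃ : ℝ, _ := fun u₃ => by
      obtain ⟨hv, hv₃, hvT⟩ := jetPolynomial_derivs j u₃ (E.F j * u₃ + E.G j)
      have hs := contDiff_jetPolynomial j u₃ (E.F j * u₃ + E.G j)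
      have h1 := h _ hs j.1 j.2.1 (by rwa [hv])
        (by rw [EvolutionEquation.SolvesAt, hv, hv₃, hvT])
      rw [prolongDelta_eq hcos E hQ hs (by rwa [hv]) hσ hρ, hv, hv₃, hvT] at h1
      exact h1
    -- The values `u₃ = 0` and `u₃ = 1` determine both coefficients.
    have k0 := key 0
    have k1 := key 1
    constructor <;> linarith
  · intro h v hv t x hj hsol
    obtain ⟨hF, hG⟩ := h _ hj _ _ rfl rfl
    rw [prolongDelta_eq hcos E hQ hv hj rfl rfl]
    rw [EvolutionEquation.SolvesAt] at hsol
    change fderiv ℝ E.F (jetOf v t x) (prolonged (a t) α _ _ (jetOf v t x)) = _ at hF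
    change fderiv ℝ E.G (jetOf v t x) (prolonged (a t) α _ _ (jetOf v t x)) = _ at hG
    erw [hF, hG, hsol]
    simp only [jetOf]
    ring

end symmetry

/-! ### Functions annihilated by the prolonged vector fields -/

/-- The function `g` is annihilated on `Ω` by the prolonged vector fields. -/
def AnnihilatedOn (Ω : Set Jet) (g : Jet → ℝ) : Prop :=
  ∀ j ∈ Ω, ∀ δ α σ ρ : ℝ, fderiv ℝ g j (prolonged δ α σ ρ j) = 0

/-- The inverse of `(t, x, u, u₁, u₂) ↦ (t, x, u, u₁, τ)`. -/
noncomputable def unstraighten (y : Jet) : Jet :=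
  (y.1, y.2.1, y.2.2.1, y.2.2.2.1,
    (y.2.2.2.2 * speedInv y ^ 3 - (1 + 2 * omegaInv y ^ 2) * Real.tan y.2.2.1)
      * Real.cos y.2.2.1 ^ 2)

/-- The map `(t, x, u, u₁, u₂) ↦ (t, x, u, u₁, τ)`. -/
noncomputable def straighten (j : Jet) : Jet :=
  (j.1, j.2.1, j.2.2.1, j.2.2.2.1, tauInv j)

theorem tauInv_unstraighten {y : Jet} (h : Real.cos y.2.2.1 ≠ 0) :
    tauInv (unstraighten y) = y.2.2.2.2 := by
  have hW := (speedInv_pos y).ne'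
  rw [tauInv_eq]
  change ((y.2.2.2.2 * speedInv y ^ 3 - (1 + 2 * omegaInv y ^ 2) * Real.tan y.2.2.1)
      * Real.cos y.2.2.1 ^ 2 * (Real.cos y.2.2.1)⁻¹ ^ 2
      + (1 + 2 * omegaInv y ^ 2) * Real.tan y.2.2.1) / speedInv y ^ 3 = _
  field_simp
  ring

theorem straighten_unstraighten {y : Jet} (h : Real.cos y.2.2.1 ≠ 0) :
    straighten (unstraighten y) = y := by
  rw [straighten, tauInv_unstraighten h]
  rfl

theorem unstraighten_straighten {j : Jet} (h : Real.cos j.2.2.1 ≠ 0) :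
    unstraighten (straighten j) = j := by
  have hW := (speedInv_pos j).ne'
  have : (tauInv j * speedInv j ^ 3 - (1 + 2 * omegaInv j ^ 2) * Real.tan j.2.2.1)
      * Real.cos j.2.2.1 ^ 2 = j.2.2.2.2 := by
    rw [tauInv_eq]
    field_simp
    ring
  change (j.1, j.2.1, j.2.2.1, j.2.2.2.1,
    (tauInv j * speedInv j ^ 3 - (1 + 2 * omegaInv j ^ 2) * Real.tan j.2.2.1)
      * Real.cos j.2.2.1 ^ 2) = j
  rw [this]

theorem contDiffAt_unstraighten {y : Jet} (h : Real.cos y.2.2.1 ≠ 0) :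
    ContDiffAt ℝ ∞ unstraighten y := by
  have ho := contDiffAt_omegaInv h
  have hW := contDiffAt_speedInv h
  have hT := contDiffAt_tan_jet h
  unfold unstraighten
  fun_prop

theorem contDiffAt_straighten {y : Jet} (h : Real.cos y.2.2.1 ≠ 0) :
    ContDiffAt ℝ ∞ straighten y := by
  have hτ := contDiffAt_tauInv h
  unfold straighten
  fun_prop

/-- On a ball in the coordinates `(t, x, u, u₁, τ)` the slices of constant `τ` are convex, and the
prolonged fields contain every direction in a slice, so `g` is constant on it. The set `V` does not
depend on `g`, so that one `V` serves both `f` and `h`. -/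
theorem exists_nhd_factor_tauInv (Ω : TopologicalSpace.Opens Jet)
    (hcos : ∀ j ∈ Ω, Real.cos j.2.2.1 ≠ 0) {j₀ : Jet} (hj₀ : j₀ ∈ Ω) :
    ∃ V : Set Jet, IsOpen V ∧ j₀ ∈ V ∧ V ⊆ Ω ∧ IsOpen (tauInv '' V) ∧
      ∀ g : Jet → ℝ, ContDiffOn ℝ ∞ g Ω → AnnihilatedOn Ω g →
        ∃ f : ℝ → ℝ, ContDiffOn ℝ ∞ f (tauInv '' V) ∧ ∀ j ∈ V, g j = f (tauInv j) := by
  have h₀ := hcos _ hj₀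
  have hcosc : Continuous fun y : Jet => Real.cos y.2.2.1 := by fun_prop
  have hU : ∀ᶠ y in 𝓝 (straighten j₀), Real.cos y.2.2.1 ≠ 0 ∧ unstraighten y ∈ Ω := by
    refine (hcosc.continuousAt (x := straighten j₀) |>.eventually_ne h₀).and ?_
    refine (contDiffAt_unstraighten (y := straighten j₀) h₀).continuousAt.eventually ?_
    rw [unstraighten_straighten h₀]
    exact Ω.isOpen.mem_nhds hj₀
  obtain ⟨r, hr, hB⟩ := Metric.eventually_nhds_iff_ball.1 hU
  -- In the sup metric, moving the first four coordinates to those of the centre does not leave the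
  -- ball.
  have hmem : ∀ j ∈ Ω, straighten j ∈ Metric.ball (straighten j₀) r →
      (j₀.1, j₀.2.1, j₀.2.2.1, j₀.2.2.2.1, tauInv j) ∈ Metric.ball (straighten j₀) r := by
    intro j _ hj
    simp only [straighten, Metric.mem_ball, Prod.dist_eq, max_lt_iff, dist_self] at hj ⊢
    exact ⟨hr, hr, hr, hr, hj.2.2.2.2⟩
  have himage : tauInv '' ((Ω : Set Jet) ∩ straighten ⁻¹' Metric.ball (straighten j₀) r)
      = {s | ((j₀.1, j₀.2.1, j₀.2.2.1, j₀.2.2.2.1, s) : Jet)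
        ∈ Metric.ball (straighten j₀) r} := by
    ext s
    constructor
    · rintro ⟨j, ⟨hj, hjB⟩, rfl⟩
      exact hmem j hj hjB
    · intro hs
      obtain ⟨hc, hΩ⟩ := hB _ hs
      refine ⟨_, ⟨hΩ, ?_⟩, tauInv_unstraighten hc⟩
      rw [Set.mem_preimage, straighten_unstraighten hc]
      exact hs
  refine ⟨Ω ∩ straighten ⁻¹' Metric.ball (straighten j₀) r, ?_, ⟨hj₀, Metric.mem_ball_self hr⟩,
    Set.inter_subset_left, ?_, ?_⟩
  · exact ContinuousOn.isOpen_inter_preimage (fun j hj =>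
      (contDiffAt_straighten (hcos j hj)).continuousAt.continuousWithinAt) Ω.isOpen
      Metric.isOpen_ball
  · rw [himage]
    exact Metric.isOpen_ball.preimage (by fun_prop)
  intro g hg hann
  refine ⟨fun s => g (unstraighten (j₀.1, j₀.2.1, j₀.2.2.1, j₀.2.2.2.1, s)), ?_, ?_⟩
  · rw [himage]
    intro s hs
    obtain ⟨hc, hΩ⟩ := hB _ hs
    have h1 : ContDiffAt ℝ ∞ (fun s : ℝ => ((j₀.1, j₀.2.1, j₀.2.2.1, j₀.2.2.2.1, s) : Jet)) s := by
      fun_prop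
    exact ((hg.contDiffAt (Ω.isOpen.mem_nhds hΩ)).comp s
      ((contDiffAt_unstraighten hc).comp s h1)).contDiffWithinAt
  · rintro j ⟨hj, hjB⟩
    have hyB := hmem j hj hjB
    obtain ⟨y, hy⟩ : ∃ y : Jet, y = (j₀.1, j₀.2.1, j₀.2.2.1, j₀.2.2.2.1, tauInv j) := ⟨_, rfl⟩
    rw [← hy] at hyB
    change g j = g (unstraighten (j₀.1, j₀.2.1, j₀.2.2.1, j₀.2.2.2.1, tauInv j))
    rw [← hy]
    -- The segment joins two points with the same `τ`. Its image under `unstraighten` therefore has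
    -- velocity in the kernel of `dτ`, that is, a prolonged vector.
    let l : ℝ → Jet := fun s => y + s • (straighten j - y)
    have hl : ∀ e, HasDerivAt l (straighten j - y) e := fun e =>
      (((hasDerivAt_id e).smul_const (straighten j - y)).const_add y).congr_deriv (one_smul _ _)
    have hlB : ∀ e ∈ Set.Icc (0 : ℝ) 1, l e ∈ Metric.ball (straighten j₀) r := fun e he =>
      (convex_ball _ _).add_smul_sub_mem hyB hjB he
    have hl5 : ∀ e, (l e).2.2.2.2 = tauInv j := fun e => by
      subst hy
      simp [l, straighten]
    have hd : ∀ e ∈ Set.Icc (0 : ℝ) 1, HasDerivAt (fun s => g (unstraighten (l s))) 0 e := by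
      intro e he
      obtain ⟨hc, hΩ⟩ := hB _ (hlB e he)
      have h1 := ((contDiffAt_unstraighten hc).differentiableAt
        (by simp)).hasFDerivAt.comp_hasDerivAt e (hl e)
      have h2 : HasDerivAt (fun s => tauInv ((unstraighten ∘ l) s)) 0 e := by
        refine (hasDerivAt_const e (tauInv j)).congr_of_eventuallyEq ?_
        filter_upwards [(hl e).continuousAt.eventually
          (Metric.isOpen_ball.mem_nhds (hlB e he))] with s hs
        rw [Function.comp_apply, tauInv_unstraighten (hB _ hs).1, hl5]
      obtain ⟨δ, α, σ, ρ, hw⟩ := exists_prolonged_of_hasDerivAt_tauInv h1 (hcos _ hΩ) h2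
      rw [hw] at h1
      have h3 := ((hg.contDiffAt (Ω.isOpen.mem_nhds hΩ)).differentiableAt
        (by simp)).hasFDerivAt.comp_hasDerivAt e h1
      exact h3.congr_deriv (hann _ hΩ δ α σ ρ)
    have hconst := constant_of_has_deriv_right_zero (a := (0 : ℝ)) (b := 1)
      (fun e he => (hd e he).continuousAt.continuousWithinAt)
      (fun e he => (hd e (Set.Ico_subset_Icc_self he)).hasDerivWithinAt) 1 (by simp)
    simpa [l, unstraighten_straighten (hcos j hj)] using hconst

/-- The local factorization makes `g` locally constant on each level set of `τ`, hence constant on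
it by connectedness. Smoothness of the resulting function is local and comes from the local factors,
whose domains are open. -/
theorem exists_factor_tauInv (Ω : TopologicalSpace.Opens Jet)
    (hcos : ∀ j ∈ Ω, Real.cos j.2.2.1 ≠ 0)
    (hlev : ∀ s : ℝ, IsPreconnected {j : Jet | j ∈ Ω ∧ tauInv j = s})
    {g : Jet → ℝ} (hg : ContDiffOn ℝ ∞ g Ω) (hann : AnnihilatedOn Ω g) :
    ∃ f : ℝ → ℝ, ContDiffOn ℝ ∞ f (tauInv '' Ω) ∧ ∀ j ∈ Ω, g j = f (tauInv j) := by
  have hconst : ∀ j ∈ Ω, ∀ k ∈ Ω, tauInv j = tauInv k → g j = g k := by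
    intro j hj k hk hjk
    have := Subtype.preconnectedSpace (hlev (tauInv j))
    have hloc : IsLocallyConstant fun i : {i : Jet | i ∈ Ω ∧ tauInv i = tauInv j} => g i := by
      rw [IsLocallyConstant.iff_eventually_eq]
      rintro ⟨i, hi, hij⟩
      obtain ⟨V, hV, hiV, -, -, hVf⟩ := exists_nhd_factor_tauInv Ω hcos hi
      obtain ⟨f, -, hf⟩ := hVf g hg hann
      filter_upwards [continuous_subtype_val.continuousAt.eventually (hV.mem_nhds hiV)] with k hk
      rw [hf _ hk, hf i hiV, k.2.2, hij]
    exact hloc.apply_eq_of_preconnectedSpace ⟨j, hj, rfl⟩ ⟨k, hk, hjk.symm⟩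
  classical
  let f : ℝ → ℝ := fun s => if h : ∃ j ∈ Ω, tauInv j = s then g h.choose else 0
  have hf : ∀ j ∈ Ω, g j = f (tauInv j) := by
    intro j hj
    have h : ∃ k ∈ Ω, tauInv k = tauInv j := ⟨j, hj, rfl⟩
    simp only [f, dif_pos h]
    exact hconst j hj _ h.choose_spec.1 h.choose_spec.2.symm
  refine ⟨f, ?_, hf⟩
  rintro _ ⟨j, hj, rfl⟩
  obtain ⟨V, -, hjV, hVΩ, hVo, hVf⟩ := exists_nhd_factor_tauInv Ω hcos hj
  obtain ⟨f', hf', hgf'⟩ := hVf g hg hann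
  have hn : tauInv '' V ∈ 𝓝 (tauInv j) := hVo.mem_nhds ⟨j, hjV, rfl⟩
  refine ((hf'.contDiffAt hn).congr_of_eventuallyEq ?_).contDiffWithinAt
  filter_upwards [hn]
  rintro _ ⟨k, hk, rfl⟩
  rw [← hf k (hVΩ hk), hgf' k hk]

/-! ### The invariant equations -/

section admits

variable {Ω : TopologicalSpace.Opens Jet}

theorem exists_hasDerivAt_line (j w : Jet) :
    ∃ l : ℝ → Jet, HasDerivAt l w 0 ∧ l 0 = j :=
  ⟨fun s => j + s • w, by simpa using ((hasDerivAt_id (0 : ℝ)).smul_const w).const_add j, by simp⟩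

/-- The determining equations for the symmetry algebra `so(3, ℝ) ⊕ ⟨∂_t⟩`. -/
def DeterminingEquations (F G : Jet → ℝ) (j : Jet) : Prop :=
  ∀ δ α σ ρ : ℝ,
    fderiv ℝ F j (prolonged δ α σ ρ j) = 3 * xiOne σ ρ j * F j ∧
    fderiv ℝ G j (prolonged δ α σ ρ j)
      = -((1 + Real.tan j.2.2.1 ^ 2) * j.2.2.2.1 * σ * G j) - prolongedThree σ ρ j * F j

theorem so3_combination_apply {M : TopologicalSpace.Opens Point} (hM : CosNeZero M)
    (α β γ δ : ℝ) {p : Point} (hp : p ∈ M) :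
    (α • so3Gen M hM 0 + β • so3Gen M hM 1 + γ • so3Gen M hM 2 + δ • dtField M : VField M).1 p
      = fieldForm (fun _ => δ) α β γ p := by
  change α • (so3Gen M hM 0).1 p + β • (so3Gen M hM 1).1 p + γ • (so3Gen M hM 2).1 p
    + δ • (dtField M).1 p = _
  rw [so3Gen_zero_apply hM hp, so3Gen_one_apply hM hp, so3Gen_two_apply hM hp, dtField,
    VField.ofFun_apply _ _ hp]
  simp only [fieldForm, Prod.smul_mk, Prod.mk_add_mk, smul_eq_mul]
  refine Prod.ext ?_ (Prod.ext ?_ ?_) <;> simp only [] <;> ring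

theorem so3Gen_mem_so3 {M : TopologicalSpace.Opens Point} (hM : CosNeZero M) (i : Fin 3) :
    so3Gen M hM i ∈ so3 M hM :=
  Submodule.subset_span (s := Set.range (so3Gen M hM)) ⟨i, rfl⟩

theorem exists_of_mem_so3 {M : TopologicalSpace.Opens Point} {hM : CosNeZero M} {X : VField M}
    (hX : X ∈ so3 M hM) :
    ∃ α β γ : ℝ, X = α • so3Gen M hM 0 + β • so3Gen M hM 1 + γ • so3Gen M hM 2 := by
  obtain ⟨c, hc⟩ := (Submodule.mem_span_range_iff_exists_fun ℝ).1 hX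
  rw [Fin.sum_univ_three] at hc
  exact ⟨_, _, _, hc.symm⟩

theorem dtField_mem (M : TopologicalSpace.Opens Point) : dtField M ∈ dtAlgebra M :=
  Submodule.mem_span_singleton_self (dtField M)

theorem admits_iff (hcos : CosNeZero (base Ω)) (E : EvolutionEquation Ω) :
    E.Admits ((so3 (base Ω) hcos).toSubmodule ⊔ (dtAlgebra (base Ω)).toSubmodule) ↔
      ∀ j ∈ Ω, DeterminingEquations E.F E.G j := by
  constructor
  · intro h j hj δ α σ ρ
    have hsc := Real.sin_sq_add_cos_sq j.2.1
    have hm : ∀ k i, k • so3Gen (base Ω) hcos i ∈ (so3 (base Ω) hcos).toSubmodule :=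
      fun k i => Submodule.smul_mem _ _ (so3Gen_mem_so3 hcos i)
    -- The coefficients of `sin` and `cos` solve `s(x) = σ`, `s'(x) = ρ` at the given point, so `σ`
    -- and `ρ` can be prescribed independently there.
    have := (isSymmetry_iff hcos E (fun p hp => so3_combination_apply hcos α
      (σ * Real.sin j.2.1 + ρ * Real.cos j.2.1) (σ * Real.cos j.2.1 - ρ * Real.sin j.2.1) δ
      hp)).1 (h _ (Submodule.add_mem_sup (Submodule.add_mem _ (Submodule.add_mem _ (hm _ 0)
        (hm _ 1)) (hm _ 2)) (Submodule.smul_mem _ δ (dtField_mem _)))) j hj σ ρ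
      (by linear_combination -σ * hsc) (by linear_combination -ρ * hsc)
    simpa using this
  · intro h Q hQ
    obtain ⟨X, hX, Y, hY, rfl⟩ := Submodule.mem_sup.1 hQ
    obtain ⟨α, β, γ, rfl⟩ := exists_of_mem_so3 hX
    obtain ⟨δ, rfl⟩ := Submodule.mem_span_singleton.1 hY
    rw [isSymmetry_iff hcos E (fun p hp => so3_combination_apply hcos α β γ δ hp)]
    intro j hj σ ρ _ _
    simpa using h j hj δ α σ ρ

theorem cos_ne_zero_of_mem (hcos : CosNeZero (base Ω)) {j : Jet} (hj : j ∈ Ω) :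
    Real.cos j.2.2.1 ≠ 0 :=
  hcos _ (proj_mem_base hj)

theorem determiningEquations_of_hasCanonicalForm (hcos : CosNeZero (base Ω))
    (E : EvolutionEquation Ω) {V : Set Jet} (hV : IsOpen V) (hVΩ : V ⊆ Ω)
    (h : HasCanonicalForm V E.F E.G) {j : Jet} (hj : j ∈ V) :
    DeterminingEquations E.F E.G j := by
  obtain ⟨f, k, hf, hk, -, hFG⟩ := h
  intro δ α σ ρ
  have hjc := cos_ne_zero_of_mem hcos (hVΩ hj)
  obtain ⟨U, -, hjU, hUV, hUo, -⟩ := exists_nhd_factor_tauInv ⟨V, hV⟩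
    (fun i hi => cos_ne_zero_of_mem hcos (hVΩ hi)) (j₀ := j) hj
  -- The functions `f` and `k` are smooth only on the image of `V`; they can be differentiated
  -- because it is a neighbourhood of `tauInv j`.
  have hn : tauInv '' V ∈ 𝓝 (tauInv j) :=
    Filter.mem_of_superset (hUo.mem_nhds ⟨j, hjU, rfl⟩) (Set.image_mono hUV)
  have hfd := ((hf.contDiffAt hn).differentiableAt (by simp)).hasDerivAt
  have hkd := ((hk.contDiffAt hn).differentiableAt (by simp)).hasDerivAt
  obtain ⟨l, hl, rfl⟩ := exists_hasDerivAt_line j (prolonged δ α σ ρ j)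
  have hτ := hl.tauInv_prolonged hjc
  have hfl := hfd.comp (0 : ℝ) hτ
  have hkl := hkd.comp (0 : ℝ) hτ
  have hlV : ∀ᶠ s in 𝓝 (0 : ℝ), l s ∈ V := hl.continuousAt.eventually (hV.mem_nhds hj)
  have hΩn := Ω.isOpen.mem_nhds (hVΩ hj)
  have hF := ((E.smooth_F.contDiffAt hΩn).differentiableAt (by simp)).hasFDerivAt.comp_hasDerivAt
    (0 : ℝ) hl
  have hG := ((E.smooth_G.contDiffAt hΩn).differentiableAt (by simp)).hasFDerivAt.comp_hasDerivAt
    (0 : ℝ) hl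
  obtain ⟨hFj, hGj⟩ := hFG _ hj
  rw [canonicalF_eq_mul] at hFj
  rw [canonicalG_eq] at hGj
  constructor
  · rw [hF.unique (((hl.canonicalF_prolonged hjc).fun_mul hfl).congr_of_eventuallyEq (by
      filter_upwards [hlV] with s hs
      rw [Function.comp_apply, (hFG _ hs).1, canonicalF_eq_mul]
      rfl)), hFj]
    simp only [Function.comp_apply]
    ring
  · rw [hG.unique ((((hl.canonicalG_prolonged hjc).fun_mul hfl).fun_add
      ((hl.speedInv_prolonged hjc).fun_mul hkl)).congr_of_eventuallyEq (by
      filter_upwards [hlV] with s hs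
      rw [Function.comp_apply, (hFG _ hs).2, canonicalG_eq]
      rfl)), hFj, hGj]
    simp only [Function.comp_apply]
    ring

theorem admits_of_hasCanonicalForm (hcos : CosNeZero (base Ω)) (E : EvolutionEquation Ω)
    (h : ∀ j ∈ Ω, ∃ V : Set Jet, IsOpen V ∧ j ∈ V ∧ V ⊆ Ω ∧ HasCanonicalForm V E.F E.G) :
    E.Admits ((so3 (base Ω) hcos).toSubmodule ⊔ (dtAlgebra (base Ω)).toSubmodule) := by
  rw [admits_iff]
  intro j hj
  obtain ⟨V, hV, hjV, hVΩ, hc⟩ := h j hj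
  exact determiningEquations_of_hasCanonicalForm hcos E hV hVΩ hc hjV

/-- The functions `f` and `h` of the canonical form, as functions on the jet space. -/
theorem exists_annihilated_of_admits (hcos : CosNeZero (base Ω)) (E : EvolutionEquation Ω)
    (hE : E.Admits ((so3 (base Ω) hcos).toSubmodule ⊔ (dtAlgebra (base Ω)).toSubmodule)) :
    ∃ f h : Jet → ℝ, ContDiffOn ℝ ∞ f Ω ∧ ContDiffOn ℝ ∞ h Ω ∧ AnnihilatedOn Ω f ∧
      AnnihilatedOn Ω h ∧ ∀ j ∈ Ω, f j ≠ 0 ∧ E.F j = canonicalF (f j) j ∧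
        E.G j = canonicalG (f j) (h j) j := by
  rw [admits_iff] at hE
  have hc : ∀ j ∈ Ω, _ := fun j hj => cos_ne_zero_of_mem hcos (j := j) hj
  have h0 : ∀ j ∈ Ω, canonicalF 1 j ≠ 0 := fun j hj => canonicalF_ne_zero one_ne_zero (hc j hj)
  have hfs : ContDiffOn ℝ ∞ (fun j => E.F j / canonicalF 1 j) Ω :=
    E.smooth_F.div (fun j hj => (contDiffAt_canonicalF 1 (hc j hj)).contDiffWithinAt) h0
  have hhs : ContDiffOn ℝ ∞ (fun j => (E.G j - canonicalG 1 0 j * (E.F j / canonicalF 1 j))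
      / speedInv j) Ω :=
    (E.smooth_G.sub (ContDiffOn.mul
      (fun j hj => (contDiffAt_canonicalG (hc j hj)).contDiffWithinAt) hfs)).div
      (fun j hj => (contDiffAt_speedInv (hc j hj)).contDiffWithinAt)
      (fun j _ => (speedInv_pos j).ne')
  -- `F` and `canonicalF 1` solve the same homogeneous linear equation, so their quotient is
  -- annihilated. Subtracting `canonicalG 1 0` times this quotient from `G` removes the
  -- inhomogeneous term, and the difference satisfies the same equation as `speedInv`.
  have key : ∀ j ∈ Ω, ∀ δ α σ ρ : ℝ,
      fderiv ℝ (fun j => E.F j / canonicalF 1 j) j (prolonged δ α σ ρ j) = 0 ∧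
      fderiv ℝ (fun j => (E.G j - canonicalG 1 0 j * (E.F j / canonicalF 1 j))
        / speedInv j) j (prolonged δ α σ ρ j) = 0 := by
    intro j hj δ α σ ρ
    obtain ⟨eF, eG⟩ := hE j hj δ α σ ρ
    have hΩn := Ω.isOpen.mem_nhds hj
    have hjc := hc j hj
    have hj0 := h0 j hj
    have hW := (speedInv_pos j).ne'
    obtain ⟨l, hl, rfl⟩ := exists_hasDerivAt_line j (prolonged δ α σ ρ j)
    have hd : ∀ {g : Jet → ℝ}, ContDiffOn ℝ ∞ g Ω →
        HasDerivAt (fun s => g (l s)) (fderiv ℝ g (l 0) (prolonged δ α σ ρ (l 0))) 0 :=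
      fun hg => ((hg.contDiffAt hΩn).differentiableAt (by simp)).hasFDerivAt.comp_hasDerivAt
        (0 : ℝ) hl
    have hF := hd E.smooth_F
    have hG := hd E.smooth_G
    rw [eF] at hF
    rw [eG] at hG
    have hf := hF.fun_div (hl.canonicalF_prolonged hjc) hj0
    have hf' : HasDerivAt (fun s => E.F (l s) / canonicalF 1 (l s)) 0 0 :=
      hf.congr_deriv (by field_simp; ring)
    refine ⟨(hd hfs).unique hf', (hd hhs).unique (((hG.fun_sub
      ((hl.canonicalG_prolonged hjc).fun_mul hf')).fun_div (hl.speedInv_prolonged hjc)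
        hW).congr_deriv ?_)⟩
    field_simp
    ring
  refine ⟨_, _, hfs, hhs, fun j hj δ α σ ρ => (key j hj δ α σ ρ).1,
    fun j hj δ α σ ρ => (key j hj δ α σ ρ).2, fun j hj => ⟨div_ne_zero (E.F_ne_zero j hj)
      (h0 j hj), ?_, ?_⟩⟩
  · rw [canonicalF_eq_mul]
    have := h0 j hj
    field_simp
  · rw [canonicalG_eq]
    have := (speedInv_pos j).ne'
    field_simp
    ring

theorem hasCanonicalForm_of_factor (E : EvolutionEquation Ω) {V : Set Jet} {f h : Jet → ℝ}
    (hfh : ∀ j ∈ V, f j ≠ 0 ∧ E.F j = canonicalF (f j) j ∧ E.G j = canonicalG (f j) (h j) j)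
    (hf : ∃ f' : ℝ → ℝ, ContDiffOn ℝ ∞ f' (tauInv '' V) ∧ ∀ j ∈ V, f j = f' (tauInv j))
    (hh : ∃ h' : ℝ → ℝ, ContDiffOn ℝ ∞ h' (tauInv '' V) ∧ ∀ j ∈ V, h j = h' (tauInv j)) :
    HasCanonicalForm V E.F E.G := by
  obtain ⟨f', hf', hff'⟩ := hf
  obtain ⟨h', hh', hhh'⟩ := hh
  refine ⟨f', h', hf', hh', ?_, fun j hj => ?_⟩
  · rintro _ ⟨j, hj, rfl⟩
    rw [← hff' j hj]
    exact (hfh j hj).1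
  · rw [← hff' j hj, ← hhh' j hj]
    exact (hfh j hj).2

theorem admits_iff_local_canonicalForm (hcos : CosNeZero (base Ω)) (E : EvolutionEquation Ω) :
    E.Admits ((so3 (base Ω) hcos).toSubmodule ⊔ (dtAlgebra (base Ω)).toSubmodule) ↔
      ∀ j ∈ Ω, ∃ V : Set Jet, IsOpen V ∧ j ∈ V ∧ V ⊆ Ω ∧ HasCanonicalForm V E.F E.G := by
  refine ⟨fun hE j hj => ?_, admits_of_hasCanonicalForm hcos E⟩
  obtain ⟨f, h, hf, hh, haf, hah, hfh⟩ := exists_annihilated_of_admits hcos E hE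
  obtain ⟨V, hV, hjV, hVΩ, -, hVf⟩ := exists_nhd_factor_tauInv Ω
    (fun j hj => cos_ne_zero_of_mem hcos hj) hj
  exact ⟨V, hV, hjV, hVΩ, hasCanonicalForm_of_factor E (fun j hj => hfh j (hVΩ hj))
    (hVf f hf haf) (hVf h hh hah)⟩

theorem admits_iff_canonicalForm (hcos : CosNeZero (base Ω))
    (hlev : ∀ s : ℝ, IsPreconnected {j : Jet | j ∈ Ω ∧ tauInv j = s}) (E : EvolutionEquation Ω) :
    E.Admits ((so3 (base Ω) hcos).toSubmodule ⊔ (dtAlgebra (base Ω)).toSubmodule) ↔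
      HasCanonicalForm (Ω : Set Jet) E.F E.G := by
  refine ⟨fun hE => ?_, fun h => admits_of_hasCanonicalForm hcos E
    fun j hj => ⟨Ω, Ω.isOpen, hj, subset_rfl, h⟩⟩
  obtain ⟨f, h, hf, hh, haf, hah, hfh⟩ := exists_annihilated_of_admits hcos E hE
  have hc : ∀ j ∈ Ω, _ := fun j hj => cos_ne_zero_of_mem hcos (j := j) hj
  exact hasCanonicalForm_of_factor E hfh (exists_factor_tauInv Ω hc hlev hf haf)
    (exists_factor_tauInv Ω hc hlev hh hah)

/-- The equation with the canonical form for `f = 1`, `h = 0`. -/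
noncomputable def canonicalEquation (hcos : CosNeZero (base Ω)) : EvolutionEquation Ω where
  F := canonicalF 1
  G := canonicalG 1 0
  smooth_F _ hj := (contDiffAt_canonicalF 1 (cos_ne_zero_of_mem hcos hj)).contDiffWithinAt
  smooth_G _ hj := (contDiffAt_canonicalG (cos_ne_zero_of_mem hcos hj)).contDiffWithinAt
  F_ne_zero _ hj := canonicalF_ne_zero one_ne_zero (cos_ne_zero_of_mem hcos hj)

theorem canonicalEquation_admits (hcos : CosNeZero (base Ω)) :
    (canonicalEquation hcos).Admits
      ((so3 (base Ω) hcos).toSubmodule ⊔ (dtAlgebra (base Ω)).toSubmodule) :=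
  admits_of_hasCanonicalForm hcos _ fun _ hj => ⟨Ω, Ω.isOpen, hj, subset_rfl,
    fun _ => 1, fun _ => 0, contDiffOn_const, contDiffOn_const, fun _ _ => one_ne_zero,
    fun _ _ => ⟨rfl, rfl⟩⟩

end admits

/-! ### Direct sum extensions -/

section extension

variable {M : TopologicalSpace.Opens Point}

theorem fderiv_apply_of_lie_eq_zero {X Q : VField M} (h : ⁅X, Q⁆ = 0) {p : Point} (hp : p ∈ M) :
    fderiv ℝ Q.1 p (X.1 p) = fderiv ℝ X.1 p (Q.1 p) := by
  have h1 := VField.lie_apply X Q hp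
  rw [h, VectorField.lieBracket] at h1
  exact (sub_eq_zero.1 h1.symm)

/-- Vector fields that commute with `so(3, ℝ)` are vertical: the stabilizer of a point acts on the
tangent plane of the sphere by rotations. -/
theorem snd_eq_zero_of_commute (hM : CosNeZero M) {Q : VField M}
    (h : ∀ i, ⁅so3Gen M hM i, Q⁆ = 0) {p : Point} (hp : p ∈ M) : (Q.1 p).2 = 0 := by
  have h0 := fderiv_apply_of_lie_eq_zero (h 0) hp
  have h1 := fderiv_apply_of_lie_eq_zero (h 1) hp
  have h2 := fderiv_apply_of_lie_eq_zero (h 2) hp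
  rw [fderiv_so3Gen_zero hM hp, so3Gen_zero_apply hM hp] at h0
  rw [fderiv_so3Gen_one hM hp, so3Gen_one_apply hM hp] at h1
  rw [fderiv_so3Gen_two hM hp, so3Gen_two_apply hM hp] at h2
  have hsc := Real.sin_sq_add_cos_sq p.2.1
  -- With coefficients frozen at `p`, this combination generates the rotation about `p`. It vanishes
  -- at `p`, and its linearization sends `(b, c)` to `(c sec² u, -b)`; commutation forces this image
  -- of the field to be zero.
  have hK : Real.sin p.2.1 • ((0, Real.tan p.2.2 * Real.sin p.2.1, Real.cos p.2.1) : Point)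
      + Real.cos p.2.1 • ((0, Real.tan p.2.2 * Real.cos p.2.1, -Real.sin p.2.1) : Point)
      - Real.tan p.2.2 • ((0, 1, 0) : Point) = 0 := by
    simp only [Prod.smul_mk, Prod.mk_add_mk, Prod.mk_sub_mk, smul_eq_mul, Prod.mk_eq_zero]
    refine ⟨by ring, by linear_combination Real.tan p.2.2 * hsc, by ring⟩
  have hL := congrArg (fderiv ℝ Q.1 p) hK
  rw [map_sub, map_add, map_smul, map_smul, map_smul, h0, h1, h2, map_zero] at hL
  simp only [Prod.smul_mk, Prod.mk_add_mk, smul_eq_mul, smul_zero, sub_zero, Prod.mk_eq_zero] at hL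
  obtain ⟨-, hL1, hL2⟩ := hL
  have hc := hM p hp
  have hu : 1 / Real.cos p.2.2 ^ 2 * (Q.1 p).2.2 = 0 := by
    linear_combination hL1 - 1 / Real.cos p.2.2 ^ 2 * (Q.1 p).2.2 * hsc
  have hx : (Q.1 p).2.1 = 0 := by linear_combination -hL2 - (Q.1 p).2.1 * hsc
  have hu' : (Q.1 p).2.2 = 0 := by
    rcases mul_eq_zero.1 hu with h | h
    · exact absurd h (by positivity)
    · exact h
  exact Prod.ext hx hu'

theorem dtField_apply {p : Point} (hp : p ∈ M) : (dtField M).1 p = (1, 0, 0) :=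
  VField.ofFun_apply _ _ hp

theorem fderiv_dtField {p : Point} (hp : p ∈ M) : fderiv ℝ (dtField M).1 p = 0 := by
  have he : (dtField M).1 =ᶠ[𝓝 p] fun _ => (1, 0, 0) := by
    filter_upwards [M.isOpen.mem_nhds hp] with q hq using dtField_apply hq
  rw [he.fderiv_eq]
  simp

theorem so3Gen_lie_dtField (hM : CosNeZero M) (i : Fin 3) : ⁅so3Gen M hM i, dtField M⁆ = 0 := by
  refine VField.ext_on fun p hp => ?_
  rw [VField.lie_apply _ _ hp, VectorField.lieBracket, fderiv_dtField hp, dtField_apply hp]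
  change 0 - fderiv ℝ (so3Gen M hM i).1 p (1, 0, 0) = 0
  rw [zero_sub, neg_eq_zero]
  fin_cases i
  · exact fderiv_so3Gen_zero hM hp _
  · exact (fderiv_so3Gen_one hM hp _).trans (by simp)
  · exact (fderiv_so3Gen_two hM hp _).trans (by simp)

theorem isDirectSumExtension_dtAlgebra (hM : CosNeZero M) (hne : ∃ p, p ∈ M) :
    IsDirectSumExtension M hM (dtAlgebra M) where
  form Q hQ := by
    obtain ⟨k, rfl⟩ := Submodule.mem_span_singleton.1 hQ
    refine ⟨fun _ => k, fun p hp => ?_⟩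
    change (k • (dtField M).1 p).1 = k
    rw [dtField_apply hp]
    simp
  commute X hX Q hQ := by
    obtain ⟨k, rfl⟩ := Submodule.mem_span_singleton.1 hQ
    obtain ⟨α, β, γ, rfl⟩ := exists_of_mem_so3 hX
    simp [so3Gen_lie_dtField]
  disjoint := by
    obtain ⟨p, hp⟩ := hne
    rw [disjoint_iff_inf_le]
    rintro X ⟨hX, hX'⟩
    obtain ⟨α, β, γ, rfl⟩ := exists_of_mem_so3 hX
    obtain ⟨k, hk⟩ := Submodule.mem_span_singleton.1 hX'
    have h1 := so3_combination_apply hM α β γ (-k) hp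
    rw [neg_smul, hk, add_neg_cancel] at h1
    have h2 : k = 0 := by simpa [fieldForm] using congrArg Prod.fst h1
    rw [LieSubalgebra.mem_bot, ← hk, h2, zero_smul]
  ne_bot h := by
    obtain ⟨p, hp⟩ := hne
    have h1 := dtField_mem M
    rw [h, LieSubalgebra.mem_bot] at h1
    have h2 := dtField_apply hp
    rw [h1] at h2
    simpa using congrArg Prod.fst h2

theorem exists_fieldForm_of_isDirectSumExtension {hM : CosNeZero M}
    {A : LieSubalgebra ℝ (VField M)} (hA : IsDirectSumExtension M hM A) {Q : VField M}
    (hQ : Q ∈ A) : ∃ a : ℝ → ℝ, ∀ p ∈ M, Q.1 p = fieldForm a 0 0 0 p := by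
  obtain ⟨a, ha⟩ := hA.form Q hQ
  refine ⟨a, fun p hp => ?_⟩
  have h := snd_eq_zero_of_commute hM (fun i => hA.commute _ (so3Gen_mem_so3 hM i) Q hQ) hp
  refine Prod.ext (ha p hp) (h.trans ?_)
  simp only [fieldForm, zero_mul, mul_zero, add_zero, sub_zero]
  rfl

end extension

/-! ### Reparametrization of time -/

/-- Used with `b = 1 / a` to define the new time. Connectedness keeps the interval of integration
inside `s`. -/
theorem exists_contDiffOn_primitive {s : Set ℝ} (hs : IsOpen s) (hc : IsPreconnected s)
    {b : ℝ → ℝ} (hb : ContDiffOn ℝ ∞ b s) :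
    ∃ T : ℝ → ℝ, ContDiffOn ℝ ∞ T s ∧ ∀ t ∈ s, HasDerivAt T (b t) t := by
  rcases s.eq_empty_or_nonempty with rfl | ⟨t₀, ht₀⟩
  · exact ⟨0, by simp, by simp⟩
  have hd : ∀ t ∈ s, HasDerivAt (fun t => ∫ r in t₀..t, b r) (b t) t := fun t ht =>
    intervalIntegral.integral_hasDerivAt_right
      ((hb.continuousOn.mono (hc.ordConnected.uIcc_subset ht₀ ht)).intervalIntegrable)
      (hb.continuousOn.stronglyMeasurableAtFilter hs t ht)
      (hb.continuousOn.continuousAt (hs.mem_nhds ht))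
  refine ⟨_, ?_, hd⟩
  rw [contDiffOn_infty_iff_deriv_of_isOpen hs]
  exact ⟨fun t ht => (hd t ht).differentiableAt.differentiableWithinAt,
    hb.congr fun t ht => (hd t ht).deriv⟩

theorem injOn_of_hasDerivAt_ne_zero {s : Set ℝ} (hc : IsPreconnected s) {T b : ℝ → ℝ}
    (hT : ∀ t ∈ s, HasDerivAt T (b t) t) (hb : ∀ t ∈ s, b t ≠ 0) : Set.InjOn T s := by
  have key : ∀ t ∈ s, ∀ r ∈ s, t < r → T t ≠ T r := by
    intro t ht r hr htr h
    have hsub := hc.ordConnected.out ht hr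
    obtain ⟨c, hc, hc0⟩ := exists_hasDerivAt_eq_zero htr
      (fun y hy => (hT y (hsub hy)).continuousAt.continuousWithinAt) h
      (fun y hy => hT y (hsub (Set.Ioo_subset_Icc_self hy)))
    exact hb c (hsub (Set.Ioo_subset_Icc_self hc)) hc0
  intro t ht r hr h
  rcases lt_trichotomy t r with h1 | h1 | h1
  · exact absurd h (key t ht r hr h1)
  · exact h1
  · exact absurd h.symm (key r hr t ht h1)

section time

variable {M : TopologicalSpace.Opens Point} {s : Set ℝ} {T b : ℝ → ℝ}

theorem hasFDerivAt_timeChange {p : Point} {d : ℝ} (hT : HasDerivAt T d p.1) :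
    HasFDerivAt (fun p : Point => ((T p.1, p.2) : Point))
      ((d • ContinuousLinearMap.fst ℝ ℝ (ℝ × ℝ)).prod (ContinuousLinearMap.snd ℝ ℝ (ℝ × ℝ))) p :=
  (hT.comp_hasFDerivAt p hasFDerivAt_fst).prodMk hasFDerivAt_snd

theorem isInvertible_timeChange {d : ℝ} (hd : d ≠ 0) :
    ((d • ContinuousLinearMap.fst ℝ ℝ (ℝ × ℝ)).prod
      (ContinuousLinearMap.snd ℝ ℝ (ℝ × ℝ))).IsInvertible := by
  refine ⟨(ContinuousLinearEquiv.smulLeft (Units.mk0 d hd)).prodCongr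
    (ContinuousLinearEquiv.refl ℝ (ℝ × ℝ)), ?_⟩
  ext <;> simp [Units.smul_def]

/-- A change of time is an equivalence transformation onto its image. -/
theorem exists_timeChange (hM : CosNeZero M) (hc : IsPreconnected s)
    (hsM : ∀ p ∈ M, p.1 ∈ s) (hTs : ContDiffOn ℝ ∞ T s)
    (hT : ∀ t ∈ s, HasDerivAt T (b t) t) (hb : ∀ t ∈ s, b t ≠ 0) :
    ∃ (M' : TopologicalSpace.Opens Point) (hM' : CosNeZero M'),
      IsEquivalenceTransformation M M' (fun p => (T p.1, p.2)) ∧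
      (∀ i, Carries (fun p => (T p.1, p.2)) (so3Gen M hM i) (so3Gen M' hM' i)) := by
  have hφ : ∀ p ∈ M, _ := fun p hp => hasFDerivAt_timeChange (p := p) (hT p.1 (hsM p hp))
  have hsm : ContDiffOn ℝ ∞ (fun p : Point => ((T p.1, p.2) : Point)) M :=
    (hTs.comp contDiff_fst.contDiffOn hsM).prodMk contDiff_snd.contDiffOn
  -- By the inverse function theorem at each point.
  have hopen : IsOpen ((fun p : Point => ((T p.1, p.2) : Point)) '' M) := by
    rw [isOpen_iff_mem_nhds]
    rintro _ ⟨p, hp, rfl⟩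
    obtain ⟨e, he⟩ := isInvertible_timeChange (hb p.1 (hsM p hp))
    have h1 := (hsm.contDiffAt (M.isOpen.mem_nhds hp)).hasStrictFDerivAt (by simp)
    rw [(hφ p hp).fderiv, ← he] at h1
    rw [← h1.map_nhds_eq_of_equiv]
    exact Filter.image_mem_map (M.isOpen.mem_nhds hp)
  have hM' : CosNeZero ⟨_, hopen⟩ := by
    rintro _ ⟨p, hp, rfl⟩
    exact hM p hp
  refine ⟨⟨_, hopen⟩, hM', ⟨hsm, ⟨Set.mapsTo_image _ _, ?_, Set.surjOn_image _ _⟩, ?_, T,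
    fun _ _ => rfl⟩, ?_⟩
  · intro p hp q hq h
    have h' : T p.1 = T q.1 ∧ p.2 = q.2 := Prod.mk.inj h
    exact Prod.ext (injOn_of_hasDerivAt_ne_zero hc hT hb (hsM p hp) (hsM q hq) h'.1) h'.2
  · intro p hp
    rw [(hφ p hp).fderiv]
    exact isInvertible_timeChange (hb p.1 (hsM p hp))
  · intro i p hp
    have hp' : ((T p.1, p.2) : Point) ∈ (⟨_, hopen⟩ : TopologicalSpace.Opens Point) :=
      ⟨p, hp, rfl⟩
    rw [(hφ p hp).fderiv]
    fin_cases i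
    · exact (congrArg _ (so3Gen_zero_apply hM hp)).trans
        (Eq.trans (by simp) (so3Gen_zero_apply hM' hp').symm)
    · exact (congrArg _ (so3Gen_one_apply hM hp)).trans
        (Eq.trans (by simp) (so3Gen_one_apply hM' hp').symm)
    · exact (congrArg _ (so3Gen_two_apply hM hp)).trans
        (Eq.trans (by simp) (so3Gen_two_apply hM' hp').symm)

end time

/-! ### Uniqueness of the direct sum extension -/

section uniqueness

variable {Ω : TopologicalSpace.Opens Jet}

/-- For `a(t) ∂_t` the equation for `F` reads `a F_t = -a' F`, that is, `a F` is locally constant in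
`t` with the other coordinates fixed. If it vanishes at one time, then `a` vanishes at nearby times
because `F ≠ 0`. -/
theorem eventually_eq_zero_of_isSymmetry (hcos : CosNeZero (base Ω)) {E : EvolutionEquation Ω}
    {Q : VField (base Ω)} (hE : E.IsSymmetry Q) {a : ℝ → ℝ}
    (hQ : ∀ p ∈ base Ω, Q.1 p = fieldForm a 0 0 0 p) {j : Jet} (hj : j ∈ Ω) (haj : a j.1 = 0) :
    ∀ᶠ t in 𝓝 j.1, a t = 0 := by
  have hmem : ∀ᶠ t in 𝓝 j.1, ((t, j.2) : Jet) ∈ Ω :=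
    (Continuous.prodMk_left j.2).continuousAt.eventually (Ω.isOpen.mem_nhds (x := (j.1, j.2)) hj)
  obtain ⟨ε, hε, hB⟩ := Metric.eventually_nhds_iff_ball.1 hmem
  have hd : ∀ t ∈ Metric.ball j.1 ε, HasDerivAt (fun t => a t * E.F (t, j.2)) 0 t := by
    intro t ht
    have htΩ := hB t ht
    have ha : HasDerivAt a (deriv a t) t :=
      ((contDiffAt_of_fieldForm hQ (proj_mem_base htΩ)).differentiableAt (by simp)).hasDerivAt
    have hF := ((E.smooth_F.contDiffAt (Ω.isOpen.mem_nhds htΩ)).differentiableAt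
      (by simp)).hasFDerivAt.comp_hasDerivAt t ((hasDerivAt_id t).prodMk (hasDerivAt_const t j.2))
    have h := ((isSymmetry_iff hcos E hQ).1 hE _ htΩ 0 0 (by simp) (by simp)).1
    have hp : prolonged (a t) 0 0 0 (t, j.2) = a t • ((1, 0) : Jet) := by
      refine Prod.ext ?_ ?_
      · simp [prolonged]
      · simp [prolonged, xiOne, xiTwo]
    simp only [hp, map_smul, xiOne, smul_eq_mul] at h
    refine (ha.fun_mul hF).congr_deriv ?_
    simp only [Function.comp_apply, id_eq]
    linear_combination h
  filter_upwards [Metric.ball_mem_nhds j.1 hε] with t ht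
  have h1 := Metric.isOpen_ball.is_const_of_deriv_eq_zero (convex_ball j.1 ε).isPreconnected
    (fun t ht => (hd t ht).differentiableAt.differentiableWithinAt)
    (fun t ht => (hd t ht).deriv) ht (Metric.mem_ball_self hε)
  simp only [haj, zero_mul] at h1
  exact (mul_eq_zero.1 h1).resolve_right (E.F_ne_zero _ (hB t ht))

/-- A symmetry `a(t) ∂_t` over a connected set vanishes everywhere or nowhere. -/
theorem eq_zero_iff_of_isSymmetry (hcos : CosNeZero (base Ω)) (hΩ : IsPreconnected (Ω : Set Jet))
    {E : EvolutionEquation Ω} {Q : VField (base Ω)} (hE : E.IsSymmetry Q) {a : ℝ → ℝ}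
    (hQ : ∀ p ∈ base Ω, Q.1 p = fieldForm a 0 0 0 p) {j k : Jet} (hj : j ∈ Ω) (hk : k ∈ Ω) :
    a j.1 = 0 ↔ a k.1 = 0 := by
  have := Subtype.preconnectedSpace hΩ
  have hloc : IsLocallyConstant fun i : (Ω : Set Jet) => a i.1.1 = 0 := by
    rw [IsLocallyConstant.iff_eventually_eq]
    rintro ⟨i, hi⟩
    have ht : Filter.Tendsto (fun i : (Ω : Set Jet) => i.1.1) (𝓝 ⟨i, hi⟩) (𝓝 i.1) :=
      (continuous_fst.comp continuous_subtype_val).continuousAt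
    -- Zeros of `a` persist nearby by the symmetry condition, nonzero values by continuity.
    by_cases h : a i.1 = 0
    · filter_upwards [ht.eventually (eventually_eq_zero_of_isSymmetry hcos hE hQ hi h)] with m hm
      simp [h, hm]
    · have hc : ContinuousAt a i.1 :=
        (contDiffAt_of_fieldForm hQ (proj_mem_base hi)).continuousAt
      filter_upwards [ht.eventually (hc.eventually_ne h)] with m hm
      simp [h, hm]
  exact (hloc.apply_eq_of_preconnectedSpace ⟨j, hj⟩ ⟨k, hk⟩).to_iff

/-- Evaluating `a` at a single time is injective on `A`, so `A` is spanned by one field `a₀(t) ∂_t`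
with `a₀` free of zeros. The time change `T' = 1 / a₀` straightens it and preserves the generators
of `so(3, ℝ)`, which do not involve `t`. -/
theorem exists_equivalence_dtAlgebra (hΩne : (Ω : Set Jet).Nonempty) (hcos : CosNeZero (base Ω))
    (hΩ : IsPreconnected (Ω : Set Jet)) {A : LieSubalgebra ℝ (VField (base Ω))}
    (hA : IsDirectSumExtension (base Ω) hcos A) (E : EvolutionEquation Ω)
    (hE : E.Admits ((so3 (base Ω) hcos).toSubmodule ⊔ A.toSubmodule)) :
    ∃ (M' : TopologicalSpace.Opens Point) (hM' : CosNeZero M') (φ : Point → Point),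
      IsEquivalenceTransformation (base Ω) M' φ ∧
      (∀ i, Carries φ (so3Gen (base Ω) hcos i) (so3Gen M' hM' i)) ∧
      CarriesOnto φ A (dtAlgebra M') := by
  have hsym : ∀ Q ∈ A, E.IsSymmetry Q := fun Q hQ => hE Q (Submodule.mem_sup_right hQ)
  obtain ⟨j₀, hj₀⟩ := hΩne
  obtain ⟨Q₀, hQ₀A, hQ₀⟩ : ∃ Q ∈ A, Q ≠ 0 := by
    by_contra! h
    exact hA.ne_bot ((LieSubalgebra.eq_bot_iff A).2 h)
  obtain ⟨a₀, ha₀⟩ := exists_fieldForm_of_isDirectSumExtension hA hQ₀A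
  have hzero : ∀ Q ∈ A, ∀ a : ℝ → ℝ, (∀ p ∈ base Ω, Q.1 p = fieldForm a 0 0 0 p) →
      a j₀.1 = 0 → Q = 0 := by
    intro Q hQA a ha h
    refine VField.ext_on fun p hp => ?_
    obtain ⟨j, hj, rfl⟩ := hp
    have h1 : a (proj j).1 = 0 :=
      (eq_zero_iff_of_isSymmetry hcos hΩ (hsym Q hQA) ha hj₀ hj).1 h
    rw [ha _ (proj_mem_base hj), fieldForm, h1]
    simp
  have h₀ : a₀ j₀.1 ≠ 0 := fun h => hQ₀ (hzero Q₀ hQ₀A a₀ ha₀ h)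
  have hspan : ∀ Q ∈ A, ∃ k : ℝ, Q = k • Q₀ := by
    intro Q hQA
    obtain ⟨a, ha⟩ := exists_fieldForm_of_isDirectSumExtension hA hQA
    -- With this ratio the difference vanishes at the time of `j₀`, hence identically.
    refine ⟨a j₀.1 / a₀ j₀.1, sub_eq_zero.1 (hzero _ (A.sub_mem hQA (A.smul_mem _ hQ₀A))
      (fun t => a t - a j₀.1 / a₀ j₀.1 * a₀ t) (fun p hp => ?_) (by field_simp; ring))⟩
    change Q.1 p - (a j₀.1 / a₀ j₀.1) • Q₀.1 p = _
    rw [ha p hp, ha₀ p hp]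
    simp only [fieldForm, zero_mul, mul_zero, add_zero, sub_zero, Prod.smul_mk, smul_eq_mul,
      Prod.mk_sub_mk]
  have hopen : IsOpen (Prod.fst '' (Ω : Set Jet)) := isOpenMap_fst _ Ω.isOpen
  have hconn : IsPreconnected (Prod.fst '' (Ω : Set Jet)) :=
    hΩ.image _ continuous_fst.continuousOn
  have ha₀ne : ∀ t ∈ Prod.fst '' (Ω : Set Jet), a₀ t ≠ 0 := by
    rintro _ ⟨j, hj, rfl⟩ h
    exact h₀ ((eq_zero_iff_of_isSymmetry hcos hΩ (hsym Q₀ hQ₀A) ha₀ hj₀ hj).2 h)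
  have hb : ContDiffOn ℝ ∞ (fun t => (a₀ t)⁻¹) (Prod.fst '' (Ω : Set Jet)) := by
    refine ContDiffOn.inv ?_ ha₀ne
    rintro _ ⟨j, hj, rfl⟩
    exact (contDiffAt_of_fieldForm ha₀ (proj_mem_base hj)).contDiffWithinAt
  obtain ⟨T, hTs, hT⟩ := exists_contDiffOn_primitive hopen hconn hb
  have hbase : ∀ p ∈ base Ω, p.1 ∈ Prod.fst '' (Ω : Set Jet) := by
    rintro _ ⟨j, hj, rfl⟩
    exact ⟨j, hj, rfl⟩
  obtain ⟨M', hM', hφ, hgen⟩ := exists_timeChange hcos hconn hbase hTs hT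
    fun t ht => inv_ne_zero (ha₀ne t ht)
  have hcar : ∀ k : ℝ, Carries (fun p => ((T p.1, p.2) : Point)) (k • Q₀) (k • dtField M') := by
    intro k p hp
    change fderiv ℝ _ p (k • Q₀.1 p) = k • (dtField M').1 _
    rw [(hasFDerivAt_timeChange (hT p.1 (hbase p hp))).fderiv, ha₀ p hp,
      dtField_apply (hφ.bijOn.mapsTo hp)]
    have := ha₀ne p.1 (hbase p hp)
    simp [fieldForm]
    field_simp
  refine ⟨M', hM', _, hφ, hgen, fun Q hQ => ?_, fun Q' hQ' => ?_⟩
  · obtain ⟨k, rfl⟩ := hspan Q hQ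
    exact ⟨_, (dtAlgebra M').smul_mem k (dtField_mem M'), hcar k⟩
  · obtain ⟨k, rfl⟩ := Submodule.mem_span_singleton.1 hQ'
    exact ⟨_, A.smul_mem k hQ₀A, hcar k⟩

end uniqueness
-- The classification
theorem corollary6p1 (Ω : TopologicalSpace.Opens Jet) (hΩ : (Ω : Set Jet).Nonempty)
    (hcos : CosNeZero (base Ω)) :
    -- the direct sum with `⟨∂_t⟩` is an extension, admitted by some equation on `Ω`
    (IsDirectSumExtension (base Ω) hcos (dtAlgebra (base Ω)) ∧
      ∃ E : EvolutionEquation Ω,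
        E.Admits ((so3 (base Ω) hcos).toSubmodule ⊔ (dtAlgebra (base Ω)).toSubmodule)) ∧
    -- every extension admitted by some equation on `Ω` is equivalent to the one by `⟨∂_t⟩`
    (IsPreconnected (Ω : Set Jet) →
      ∀ A : LieSubalgebra ℝ (VField (base Ω)), IsDirectSumExtension (base Ω) hcos A →
        (∃ E : EvolutionEquation Ω,
          E.Admits ((so3 (base Ω) hcos).toSubmodule ⊔ A.toSubmodule)) →
        ∃ (M' : TopologicalSpace.Opens Point) (hM' : CosNeZero M') (φ : Point → Point),
          IsEquivalenceTransformation (base Ω) M' φ ∧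
          (∀ i, Carries φ (so3Gen (base Ω) hcos i) (so3Gen M' hM' i)) ∧
          CarriesOnto φ A (dtAlgebra M')) ∧
    -- the equations that admit the extension by `⟨∂_t⟩`
    (∀ E : EvolutionEquation Ω,
      E.Admits ((so3 (base Ω) hcos).toSubmodule ⊔ (dtAlgebra (base Ω)).toSubmodule) ↔
        ∀ j ∈ Ω, ∃ V : Set Jet, IsOpen V ∧ j ∈ V ∧ V ⊆ Ω ∧ HasCanonicalForm V E.F E.G) ∧
    -- one pair of functions `f`, `h` serves all of `Ω` if the level sets of `τ` are connected
    ((∀ s : ℝ, IsPreconnected {j : Jet | j ∈ Ω ∧ tauInv j = s}) →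
      ∀ E : EvolutionEquation Ω,
        E.Admits ((so3 (base Ω) hcos).toSubmodule ⊔ (dtAlgebra (base Ω)).toSubmodule) ↔
          HasCanonicalForm (Ω : Set Jet) E.F E.G) :=
  ⟨⟨isDirectSumExtension_dtAlgebra hcos
      (hΩ.elim fun _ hj => ⟨_, proj_mem_base hj⟩),
      _, canonicalEquation_admits hcos⟩,
    fun hconn _ hA ⟨E, hE⟩ => exists_equivalence_dtAlgebra hΩ hcos hconn hA E hE,
    admits_iff_local_canonicalForm hcos, fun hlev E => admits_iff_canonicalForm hcos hlev E⟩
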